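/- **Setting.** Let $f:\mathbb R^n\to\mathbb R$, $A_{eq}:\mathbb R^n\to\mathbb R^{m\times n}$, $A_{ineq}:\mathbb R^n\to\mathbb R^{p\times n}$, $d_{eq}\in\mathbb R^m$, $d_{ineq}\in\mathbb R^p$, and suppose that $f$, $g_{eq}:=A_{eq}\nabla f+d_{eq}$ and $g_{ineq}:=A_{ineq}\nabla f+d_{ineq}$ are differentiable. Consider the problem of minimising $f(z)$ subject to $g_{eq}(z)=0$, $g_{ineq}(z)\le 0$. Let $\mathcal G_{ineq}=\{z: g_{ineq}(z)\le 0\}$, $\Gamma=\{z\in\mathcal G_{ineq}: g_{eq}(z)=0\}$, $\mathcal I(z)=\{i: g_{ineq,i}(z)=0\}$ and $\mathcal S=\{s\subseteq\{1,\dots,p\}: s\subseteq\mathcal I(z)\text{ for some }z\in\mathbb R^n\}$. A point $z$ satisfies the KKT conditions if $z\in\Gamma$ and there are $\lambda\in\mathbb R^m$, $\nu\in\mathbb R^p$ with $\nu\ge 0$, $\nu_i\,g_{ineq,i}(z)=0$ for all $i$, and $\nabla f(z)+\frac{\partial^\top g_{eq}}{\partial z}(z)\lambda+\frac{\partial^\top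 g_{ineq}}{\partial z}(z)\nu=0$. For $\mathcal A\in\mathcal S$ with $a$ elements let $E_{\mathcal A}\in\mathbb R^{a\times p}$ have the rows $e_i^\top$, $i\in\mathcal A$, and put $A_{\mathcal A}=\begin{bmatrix}A_{eq}\\E_{\mathcal A}A_{ineq}\end{bmatrix}$, $d_{\mathcal A}=\begin{bmatrix}d_{eq}\\E_{\mathcal A}d_{ineq}\end{bmatrix}$, $g_{\mathcal A}=A_{\mathcal A}\nabla f+d_{\mathcal A}$, $B_{\mathcal A}=\frac{\partial g_{\mathcal A}}{\partial z}A_{\mathcal A}^\top$. Assume that for each $\mathcal A\in\mathcal S$ there are constants $\beta^1_{\mathcal A},\beta^2_{\mathcal A}>0$ such that for all $z\in\mathcal G_{ineq}$ the matrix $B_{\mathcal A}(z)$ is invertible and $\frac12[B_{\mathcal A}+B_{\mathcal A}^\top]\ge\frac12\beta^1_{\mathcal A}B_{\mathcal A}B_{\mathcal A}^\top\ge\beta^2_{\mathcal A}I$. Let $G^\perp_{\mathcal A}(z)\in\mathbb R^{(n-m-a)\times n}$ have full rank and satisfy $G^\perp_{\mathcal A}(z)\frac{\partial^\top g_{\mathcal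 A}}{\partial z}(z)=0$ for $z\in\mathcal G_{ineq}$. With $\kappa_1,\kappa_2,\delta T>0$ the subsystem $\mathcal A$ is $$\dot z=h_{\mathcal A}(z)=-\left[\kappa_1A_{\mathcal A}^\top B_{\mathcal A}^{-1}A_{\mathcal A}+\kappa_2G_{\mathcal A}^{\perp\top}G^\perp_{\mathcal A}\right]\nabla f-\kappa_1A_{\mathcal A}^\top B_{\mathcal A}^{-1}d_{\mathcal A}.$$ **Switching law.** At time $t$, with point $z$, active set $\sigma$ and time $T_s$ of the last removal, every $i\in\mathcal I(z)\setminus\sigma$ with $\frac{\partial g_{ineq,i}}{\partial z}(z)h_\sigma(z)\ge 0$ is added to $\sigma$. An index $k\in\sigma$ qualifies for removal if $\frac{\partial g_{ineq,k}}{\partial z}(z)h_{\sigma\setminus\{k\}}(z)<0$ and $t>T_s+\delta T$; if some index qualifies, then one such index is removed and $T_s$ is set to $t$. The result is $\sigma(t^+)$. A trajectory is a pair $(z,\sigma)$ on $[0,\infty)$ with $z(0)\in\mathcal G_{ineq}$, $\sigma$ piecewise constant and left-continuous with values in $\mathcal S$, $z$ a Carathéodory solution of $\dot z=h_\sigma(z)$,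 and $\sigma(t^+)$ given by the law for all $t\ge0$. Let $\mathcal T^\star$ be any family of complete trajectories that contains all trajectories with $\sigma(0)=\mathcal I(z(0))$, and whose members satisfy $\sigma(0)\subseteq\mathcal I(z(0))$ and obey the law, except that a removal may come later than at the first possible moment, as long as no removal condition is ignored forever. A nonempty $M\subseteq\mathbb R^n\times\mathcal S$ is weakly invariant if for every $(\xi,\gamma)\in M$ some $(z,\sigma)\in\mathcal T^\star$ has $z(0)=\xi$, $\sigma(0)=\gamma$ and $(z(t),\sigma(t))\in M$ for all $t\ge 0$. For a sublevel set $\mathcal F0$ of $f$ let $$\Omega=\mathcal F0\cap\{z\in\Gamma:\ \exists \mathcal A\in\mathcal S\text{ with }\mathcal A\subseteq\mathcal I(z)\text{ and }G^\perp_{\mathcal A}(z)\nabla f(z)=0\}.$$ **Proposition.** 1. For every sublevel set $\mathcal F0$, each point $z$ of each pair $(z,\gamma)$ in the largest weakly invariant set contained in $\Omega\times\mathcal S$ satisfies the KKT conditions. 2. Let $\bar z\in\mathcal G_{ineq}$ be an equilibrium of the subsystem $\mathcal A\in\mathcal S$, and let $\bar\lambda\in\mathbb R^m$, $\bar\nu\in\mathbb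 R^a$ satisfy $\nabla f(\bar z)+\frac{\partial^\top g_{eq}}{\partial z}(\bar z)\bar\lambda+\frac{\partial^\top g_{ineq}}{\partial z}(\bar z)E_{\mathcal A}^\top\bar\nu=0$. If $\bar\nu_k<0$ for some $k\in\mathcal A$, then $g_{ineq,k}$ and $f$ have strictly negative derivatives at $\bar z$ along $h_{\mathcal A\setminus\{k\}}$. At $(\bar z,\mathcal A)$, as soon as $t>T_s+\delta T$, the removal of $k$ is a possible result of the law (giving $\mathcal I(\bar z)\setminus\{k\}$), and every result is $\mathcal I(\bar z)\setminus\{j\}$ for some $j\in\mathcal A$ with $\bar\nu_j<0$, with $f$ having a strictly negative derivative at $\bar z$ along the new subsystem. No trajectory in $\mathcal T^\star$ stays at $\bar z$ for all time, and $\bar z$ is not a point of the largest weakly invariant set contained in $\Omega\times\mathcal S$. 3. With $\bar z,\mathcal A,\bar\lambda,\bar\nu$ as in 2, if instead $\bar\nu\ge0$, then $\bar z$ satisfies the KKT conditions and is an equilibrium of the subsystem $\mathcal I(\bar z)$. At $\bar z$ the law maps the active set $\mathcal A$ to $\mathcal I(\bar z)$, and $\mathcal I(\bar z)$ to itself, for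 all values of $t$ and $T_s$ and without removal. The set $\{(\bar z,\mathcal I(\bar z))\}$ is weakly invariant. If $h_{\mathcal I(\bar z)}$ is Lipschitz in a neighbourhood of $\bar z$, then every trajectory in $\mathcal T^\star$ that starts at $(\bar z,\mathcal I(\bar z))$ stays there. -/

import Mathlib

open Filter Topology Matrix MeasureTheory

noncomputable section

/-- The gradient of `u` at `z`, as the vector of partial derivatives. -/
def gradVec {n : ℕ} (u : (Fin n → ℝ) → ℝ) (z : Fin n → ℝ) : Fin n → ℝ :=
  fun j => fderiv ℝ u z (Pi.single j 1)

/-- Data of the optimisation problem `min f(z)` subject to `Aeq(z) ∇f(z) + deq = 0` and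
`Aineq(z) ∇f(z) + dineq ≤ 0`, with the parameters of the optimisation dynamics: the gains
`κ₁, κ₂`, the minimum time `δT` between removals, and, for every set `A` of inequality indices,
the matrix function `G_A^⊥`. -/
structure SwitchedProblem (n m p : ℕ) where
  f : (Fin n → ℝ) → ℝ
  Aeq : (Fin n → ℝ) → Matrix (Fin m) (Fin n) ℝ
  Aineq : (Fin n → ℝ) → Matrix (Fin p) (Fin n) ℝ
  deq : Fin m → ℝ
  dineq : Fin p → ℝ
  κ₁ : ℝ
  κ₂ : ℝ
  δT : ℝ
  Gperp : (A : Finset (Fin p)) → (Fin n → ℝ) → Matrix (Fin (n - m - A.card)) (Fin n) ℝ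

namespace SwitchedProblem

variable {n m p : ℕ} (P : SwitchedProblem n m p)

/-- The gradient of the objective function. -/
def gradf (z : Fin n → ℝ) : Fin n → ℝ := gradVec P.f z

def geq (z : Fin n → ℝ) : Fin m → ℝ := P.Aeq z *ᵥ P.gradf z + P.deq

def gineq (z : Fin n → ℝ) : Fin p → ℝ := P.Aineq z *ᵥ P.gradf z + P.dineq

/-- The Jacobian matrix of the equality constraints. -/
def Jeq (z : Fin n → ℝ) : Matrix (Fin m) (Fin n) ℝ :=
  Matrix.of fun i => gradVec (fun w => P.geq w i) z

/-- The Jacobian matrix of the inequality constraints. -/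
def Jineq (z : Fin n → ℝ) : Matrix (Fin p) (Fin n) ℝ :=
  Matrix.of fun i => gradVec (fun w => P.gineq w i) z

/-- The set on which the inequality constraints hold. -/
def Gineq : Set (Fin n → ℝ) := {z | ∀ i, P.gineq z i ≤ 0}

/-- The set on which the equality constraints hold. -/
def Geq : Set (Fin n → ℝ) := {z | P.geq z = 0}

/-- The feasible set. -/
def Gam : Set (Fin n → ℝ) := P.Gineq ∩ P.Geq

/-- The Karush-Kuhn-Tucker conditions at `z`. -/
def KKT (z : Fin n → ℝ) : Prop :=
  ∃ (lam : Fin m → ℝ) (nu : Fin p → ℝ),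
    P.gradf z + (P.Jeq z)ᵀ *ᵥ lam + (P.Jineq z)ᵀ *ᵥ nu = 0 ∧
    P.geq z = 0 ∧ (∀ i, P.gineq z i ≤ 0) ∧ (∀ i, 0 ≤ nu i) ∧ (∀ i, nu i * P.gineq z i = 0)

open Classical in
/-- `𝓘(z)`: the indices of the inequality constraints that hold with equality at `z`. -/
def idx (z : Fin n → ℝ) : Finset (Fin p) := Finset.univ.filter fun i => P.gineq z i = 0

/-- `𝓢`: the sets of inequality constraints that can hold with equality simultaneously. -/
def indexSets : Set (Finset (Fin p)) := {s | ∃ z : Fin n → ℝ, s ⊆ P.idx z}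

/-- `E_A v`: the entries of `v` with index in `A`. -/
def restr (A : Finset (Fin p)) (v : Fin p → ℝ) : {i // i ∈ A} → ℝ := fun i => v i

/-- `A_A(z)`: the rows of `Aeq(z)`, followed by those rows of `Aineq(z)` with index in `A`. -/
def AA (A : Finset (Fin p)) (z : Fin n → ℝ) : Matrix (Fin m ⊕ {i // i ∈ A}) (Fin n) ℝ :=
  Matrix.of (Sum.elim (fun i => P.Aeq z i) (fun i => P.Aineq z i.1))

/-- `d_A`. -/
def dA (A : Finset (Fin p)) : Fin m ⊕ {i // i ∈ A} → ℝ := Sum.elim P.deq (restr A P.dineq)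

/-- `∂g_A/∂z`. -/
def JA (A : Finset (Fin p)) (z : Fin n → ℝ) : Matrix (Fin m ⊕ {i // i ∈ A}) (Fin n) ℝ :=
  Matrix.of (Sum.elim (fun i => P.Jeq z i) (fun i => P.Jineq z i.1))

/-- `B_A(z) = (∂g_A/∂z) A_Aᵀ`. -/
def BA (A : Finset (Fin p)) (z : Fin n → ℝ) :
    Matrix (Fin m ⊕ {i // i ∈ A}) (Fin m ⊕ {i // i ∈ A}) ℝ :=
  P.JA A z * (P.AA A z)ᵀ

/-- The vector field `h_A` of the subsystem with active set `A`. -/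
def h (A : Finset (Fin p)) (z : Fin n → ℝ) : Fin n → ℝ :=
  -((P.κ₁ • ((P.AA A z)ᵀ * (P.BA A z)⁻¹ * P.AA A z)
      + P.κ₂ • ((P.Gperp A z)ᵀ * P.Gperp A z)) *ᵥ P.gradf z)
    - P.κ₁ • (((P.AA A z)ᵀ * (P.BA A z)⁻¹) *ᵥ P.dA A)

/-- The standing assumptions: differentiable data, positive tuning parameters, the technical
assumption on `B_A` on the set `Gineq`, and the choice of `G_A^⊥` as a full rank left annihilator
of the transposed Jacobian of the active constraints. -/
structure Admissible : Prop where
  diff_f : Differentiable ℝ P.f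
  diff_geq : Differentiable ℝ P.geq
  diff_gineq : Differentiable ℝ P.gineq
  κ₁_pos : 0 < P.κ₁
  κ₂_pos : 0 < P.κ₂
  δT_pos : 0 < P.δT
  B_pos : ∀ A ∈ P.indexSets, ∃ β₁ β₂ : ℝ, 0 < β₁ ∧ 0 < β₂ ∧ ∀ z ∈ P.Gineq,
    IsUnit (P.BA A z) ∧
    ((1 / 2 : ℝ) • (P.BA A z + (P.BA A z)ᵀ)
      - (1 / 2 * β₁) • (P.BA A z * (P.BA A z)ᵀ)).PosSemidef ∧
    ((1 / 2 * β₁) • (P.BA A z * (P.BA A z)ᵀ)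
      - β₂ • (1 : Matrix (Fin m ⊕ {i // i ∈ A}) (Fin m ⊕ {i // i ∈ A}) ℝ)).PosSemidef
  annihilator : ∀ A ∈ P.indexSets, ∀ z ∈ P.Gineq,
    P.Gperp A z * (P.JA A z)ᵀ = 0 ∧ (P.Gperp A z).rank = n - m - A.card

/-! The switching law. Its inputs are the time `t`, the point `z`, the active set `s` and the time
`τ` of the last removal; its outputs are the updated active set `s'` and the updated time `τ'`. -/

open Classical in
/-- The indices that the switching law adds: constraints outside the active set that hold with
equality and do not decrease along the current subsystem. -/
def addIdx (z : Fin n → ℝ) (s : Finset (Fin p)) : Finset (Fin p) :=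
  (P.idx z \ s).filter fun i => 0 ≤ P.Jineq z i ⬝ᵥ P.h s z

/-- The condition under which the switching law removes the index `k`. -/
def Removable (t : ℝ) (z : Fin n → ℝ) (s : Finset (Fin p)) (τ : ℝ) (k : Fin p) : Prop :=
  k ∈ s ∧ P.Jineq z k ⬝ᵥ P.h (s \ {k}) z < 0 ∧ τ + P.δT < t

/-- One execution of the switching law: all indices that qualify are added. If some index
qualifies for removal, then exactly one such index (the first one that the loop meets, in an order
that is not prescribed) is removed, because the removal sets the clock to `t`. -/
def LawStep (t : ℝ) (z : Fin n → ℝ) (s : Finset (Fin p)) (τ : ℝ)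
    (s' : Finset (Fin p)) (τ' : ℝ) : Prop :=
  ((∀ k, ¬ P.Removable t z s τ k) ∧ s' = s ∪ P.addIdx z s ∧ τ' = τ) ∨
  (∃ k, P.Removable t z s τ k ∧ s' = (s ∪ P.addIdx z s) \ {k} ∧ τ' = t)

/-- The same, except that a removal is permitted, but not enforced, when its condition holds. -/
def DelayedStep (t : ℝ) (z : Fin n → ℝ) (s : Finset (Fin p)) (τ : ℝ)
    (s' : Finset (Fin p)) (τ' : ℝ) : Prop :=
  (s' = s ∪ P.addIdx z s ∧ τ' = τ) ∨
  (∃ k, P.Removable t z s τ k ∧ s' = (s ∪ P.addIdx z s) \ {k} ∧ τ' = t)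

/-- `(z, σ)` is a complete (defined for all `t ≥ 0`) Carathéodory solution of `ż = h_σ(z)` with
`z(0) ∈ Gineq`, where `σ` is piecewise constant with values in `𝓢`, `T t` is the time of the last
removal before `t`, and at every `t ≥ 0` the values `σ(t⁺)`, `T(t⁺)` result from `σ(t)`, `T(t)` by
the update rule `step`. -/
structure IsRun
    (step : ℝ → (Fin n → ℝ) → Finset (Fin p) → ℝ → Finset (Fin p) → ℝ → Prop)
    (z : ℝ → Fin n → ℝ) (σ : ℝ → Finset (Fin p)) (T : ℝ → ℝ) : Prop where
  init : z 0 ∈ P.Gineq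
  clock : T 0 ≤ 0
  mem : ∀ t, 0 ≤ t → σ t ∈ P.indexSets
  integrable : ∀ t, 0 ≤ t → IntervalIntegrable (fun r => P.h (σ r) (z r)) volume 0 t
  solution : ∀ t, 0 ≤ t → z t = z 0 + ∫ r in (0 : ℝ)..t, P.h (σ r) (z r)
  left : ∀ t, 0 < t → ∀ᶠ r in 𝓝[<] t, σ r = σ t ∧ T r = T t
  update : ∀ t, 0 ≤ t → ∃ s' τ', step t (z t) (σ t) (T t) s' τ' ∧
    ∀ᶠ r in 𝓝[>] t, σ r = s' ∧ T r = τ'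

/-- The complete solutions of the switched system: the switching law is executed at every time,
and the active set is initialised as `σ(0) = 𝓘(z(0))`. -/
def promptFamily : Set ((ℝ → Fin n → ℝ) × (ℝ → Finset (Fin p))) :=
  {x | ∃ T, P.IsRun P.LawStep x.1 x.2 T ∧ x.2 0 = P.idx (x.1 0)}

/-- A larger family. First, a trajectory may start at a later stage of a solution,
`σ(0) ⊆ 𝓘(z(0))`. Secondly, a removal may come later than at the first possible moment, as long as
no removal condition is ignored forever. (The conditions for a removal are strict inequalities. If
they start to hold along a trajectory, there may be no first instant at which they hold, and then
no trajectory executes the removal without delay.) -/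
def delayedFamily : Set ((ℝ → Fin n → ℝ) × (ℝ → Finset (Fin p))) :=
  {x | ∃ T, P.IsRun P.DelayedStep x.1 x.2 T ∧ x.2 0 ⊆ P.idx (x.1 0) ∧
    ∀ k, ∃ᶠ t in atTop, ¬ P.Removable t (x.1 t) (x.2 t) (T t) k}

/-- Weak invariance of a set of pairs (point, active set) with respect to a family of complete
trajectories. -/
def WeaklyInvariant (F : Set ((ℝ → Fin n → ℝ) × (ℝ → Finset (Fin p))))
    (M : Set ((Fin n → ℝ) × Finset (Fin p))) : Prop :=
  M.Nonempty ∧ (∀ x ∈ M, x.2 ∈ P.indexSets) ∧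
  ∀ x ∈ M, ∃ y ∈ F, y.1 0 = x.1 ∧ y.2 0 = x.2 ∧ ∀ t : ℝ, 0 ≤ t → (y.1 t, y.2 t) ∈ M

/-- The largest weakly invariant set contained in `Om`: the union of all of them. -/
def largestInvariant (F : Set ((ℝ → Fin n → ℝ) × (ℝ → Finset (Fin p))))
    (Om : Set (Fin n → ℝ)) : Set ((Fin n → ℝ) × Finset (Fin p)) :=
  ⋃₀ {M | P.WeaklyInvariant F M ∧ ∀ x ∈ M, x.1 ∈ Om}

/-- `Ω`: the feasible points of the sublevel set `{f ≤ c}` at which `G_A^⊥ ∇f = 0` for some set `A`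
of constraints that are active there. -/
def Omega (c : ℝ) : Set (Fin n → ℝ) :=
  {z | P.f z ≤ c} ∩
    {z | z ∈ P.Gam ∧ ∃ A ∈ P.indexSets, A ⊆ P.idx z ∧ P.Gperp A z *ᵥ P.gradf z = 0}

/-- `lam` and `nu` are Lagrange multipliers of the subsystem with active set `A` at `z`:
`∇f + (∂g_eq/∂z)ᵀ lam + (∂g_ineq/∂z)ᵀ E_Aᵀ nu = 0`. -/
def IsMultiplier (A : Finset (Fin p)) (z : Fin n → ℝ)
    (lam : Fin m → ℝ) (nu : {i // i ∈ A} → ℝ) : Prop :=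
  P.gradf z + (P.JA A z)ᵀ *ᵥ (Sum.elim lam nu) = 0

variable {P}

/-- The union of all weakly invariant subsets is weakly invariant, unless it is empty. -/
theorem weaklyInvariant_largestInvariant
    {F : Set ((ℝ → Fin n → ℝ) × (ℝ → Finset (Fin p)))} {Om : Set (Fin n → ℝ)}
    (hne : (P.largestInvariant F Om).Nonempty) :
    P.WeaklyInvariant F (P.largestInvariant F Om) := by
  refine ⟨hne, ?_, ?_⟩
  · rintro x ⟨M, hM, hx⟩
    exact hM.1.2.1 x hx
  · rintro x ⟨M, hM, hx⟩
    obtain ⟨y, hy, h0, h1, h2⟩ := hM.1.2.2 x hx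
    exact ⟨y, hy, h0, h1, fun t ht => ⟨M, hM, h2 t ht⟩⟩

/-- Every solution that executes the switching law at every time belongs to the larger family. -/
theorem promptFamily_subset_delayedFamily (hδ : 0 < P.δT) :
    P.promptFamily ⊆ P.delayedFamily := by
  rintro x ⟨T, hrun, h0⟩
  refine ⟨T, ⟨hrun.init, hrun.clock, hrun.mem, hrun.integrable, hrun.solution, hrun.left, ?_⟩,
    h0.le, ?_⟩
  · intro t ht
    obtain ⟨s', τ', hs, hev⟩ := hrun.update t ht
    refine ⟨s', τ', ?_, hev⟩
    rcases hs with ⟨_, h1⟩ | h1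
    · exact Or.inl h1
    · exact Or.inr h1
  · intro k
    rw [frequently_atTop]
    intro a
    by_contra! hcon
    have ha : a ≤ max a 0 := le_max_left _ _
    have ha0 : (0 : ℝ) ≤ max a 0 := le_max_right _ _
    obtain ⟨s', τ', hs, hev⟩ := hrun.update _ ha0
    rcases hs with ⟨h1, _⟩ | ⟨j, _, _, hτ⟩
    · exact h1 k (hcon _ ha)
    · have h2 : ∀ᶠ r in 𝓝[>] (max a 0), r < max a 0 + P.δT ∧ max a 0 < r := by
        filter_upwards [self_mem_nhdsWithin,
          mem_nhdsWithin_of_mem_nhds (Iio_mem_nhds (show max a 0 < max a 0 + P.δT by linarith))]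
          with r hr1 hr2 using ⟨hr2, hr1⟩
      obtain ⟨r, ⟨_, hr⟩, hr2, hr3⟩ := (hev.and h2).exists
      have := (hcon r (by linarith)).2.2
      rw [hr, hτ] at this
      linarith

end SwitchedProblem

end

noncomputable section

/-! At a feasible point with `A ⊆ 𝓘(z)`, `g_A` vanishes and `h_A = -κ₂ G_A^⊥ᵀ G_A^⊥ ∇f`.
Invertibility of `B_A` makes the gradients of the constraints in `A` linearly independent, and a
dimension count identifies the kernel of `G_A^⊥` with their span. So the subsystem equilibria in
`Gineq` are feasible points that carry multipliers. If `N k` is the multiplier of `k ∈ A` and `G` is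
the annihilator for `A \ {k}`, then `G ∇f = -N k • G ∇g_k` with `G ∇g_k ≠ 0`. Along `h_{A \ {k}}`
the constraint `g_k` thus has derivative `c * N k` and `f` has derivative `-(c * N k ^ 2)` with `c >
0` (`derivatives_of_removal`). The removal test therefore reads off the sign of the multiplier,
which settles the pointwise claims.

For invariance, a trajectory that remains in `Ω` must rest (`rest_of_mem_Omega`). While `σ` is
constant, its constraints stay active. Any other active constraint is at a maximum along the curve,
has derivative zero at almost every time, and would have been added. So `σ` is the full active set
almost everywhere, and its field vanishes on `Ω`. A resting trajectory has no further switches, so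
its clock is frozen; a negative multiplier would make its index removable at all late times, which
is excluded (`multiplier_nonneg_of_rest`).

The constraints are only differentiable, so their composition with an absolutely continuous curve
need not be absolutely continuous. Monotonicity comes from `le_of_ae_fderiv_nonneg`. -/

/-! ### Monotonicity from a derivative sign almost everywhere. -/

/-- Induction along a real interval. -/
theorem interval_induction {Q : ℝ → Prop} {a b : ℝ} (ha : Q a)
    (hstep : ∀ t, a ≤ t → t < b → Q t → ∀ᶠ s in 𝓝[>] t, Q s)
    (hlim : ∀ t, a < t → t ≤ b → (∀ s, a ≤ s → s < t → Q s) → Q t) :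
    ∀ t, a ≤ t → t ≤ b → Q t := by
  by_contra! hcon
  obtain ⟨t₀, h1, h2, h3⟩ := hcon
  set S : Set ℝ := {t | a ≤ t ∧ t ≤ b ∧ ¬ Q t} with hS
  have hne : S.Nonempty := ⟨t₀, h1, h2, h3⟩
  have hbd : BddBelow S := ⟨a, fun t ht => ht.1⟩
  set c := sInf S with hc
  have hac : a ≤ c := le_csInf hne fun t ht => ht.1
  have hcb : c ≤ b := (csInf_le hbd ⟨h1, h2, h3⟩).trans h2
  have hbelow : ∀ s, a ≤ s → s < c → Q s := by
    intro s hs hsc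
    by_contra hQ
    exact absurd (csInf_le hbd ⟨hs, hsc.le.trans hcb, hQ⟩) (not_le.2 hsc)
  have hQc : Q c := by
    rcases hac.eq_or_lt with h | h
    · exact h ▸ ha
    · exact hlim c h hcb hbelow
  rcases hcb.eq_or_lt with h | h
  · obtain rfl : t₀ = c := le_antisymm (h ▸ h2) (csInf_le hbd ⟨h1, h2, h3⟩)
    exact h3 hQc
  · have hev := hstep c hac h hQc
    obtain ⟨d, hd, hsub⟩ := mem_nhdsGT_iff_exists_Ioo_subset.1 hev
    obtain ⟨s, hs, hsd⟩ := exists_lt_of_csInf_lt hne (show sInf S < d from hd)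
    have hcs : c ≤ s := csInf_le hbd hs
    rcases hcs.eq_or_lt with h' | h'
    · exact hs.2.2 (h' ▸ hQc)
    · exact hs.2.2 (hsub ⟨h', hsd⟩)

/-- For a continuous function to be increasing it suffices that it has a nonnegative derivative
almost everywhere, if its increments are locally controlled by the measure at every point. -/
theorem le_of_ae_deriv_nonneg_of_increment_le {u : ℝ → ℝ} {a b : ℝ} (hab : a ≤ b)
    (hu : ContinuousOn u (Set.Icc a b)) (μ : Measure ℝ) [IsFiniteMeasure μ]
    (hderiv : ∀ᵐ t ∂μ, t ∈ Set.Ico a b → ∃ c, 0 ≤ c ∧ HasDerivAt u c t)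
    (hinc : ∀ t ∈ Set.Ico a b, ∃ k : ℕ, ∀ᶠ s in 𝓝[>] t, |u s - u t| ≤ k * μ.real (Set.Ioc t s)) :
    u a ≤ u b := by
  suffices H : ∀ ε : ℝ, 0 < ε → u a ≤ u b + ε + ε * (b - a) by
    have hlim : Tendsto (fun ε : ℝ => u b + ε + ε * (b - a)) (𝓝[>] 0) (𝓝 (u b + 0 + 0 * (b - a))) :=
      (Continuous.tendsto (by fun_prop) 0).mono_left nhdsWithin_le_nhds
    simpa using ge_of_tendsto hlim (eventually_mem_nhdsWithin.mono fun ε hε => H ε hε)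
  intro ε hε
  set N : Set ℝ := {t | ¬ (t ∈ Set.Ico a b → ∃ c, 0 ≤ c ∧ HasDerivAt u c t)} with hN
  have hN0 : μ N = 0 := hderiv
  obtain ⟨δ, hδ, hδsum⟩ := ENNReal.exists_pos_sum_of_countable
    (ENNReal.ofReal_pos.2 hε).ne' ℕ
  have hU : ∀ k : ℕ, ∃ U, N ⊆ U ∧ IsOpen U ∧ (k : ENNReal) * μ U ≤ δ k := by
    intro k
    -- Outer regularity of `μ` at the null set; dividing by `k + 1` instead of `k` covers `k = 0`.
    obtain ⟨U, hNU, hUo, hUm⟩ := N.exists_isOpen_le_add μ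
      (ε := δ k / (k + 1)) (by simpa using (hδ k).ne')
    refine ⟨U, hNU, hUo, ?_⟩
    rw [hN0, zero_add] at hUm
    calc (k : ENNReal) * μ U ≤ (k + 1) * (δ k / (k + 1)) := by gcongr; exact le_self_add
      _ = δ k := ENNReal.mul_div_cancel (by simp) (by finiteness)
  choose U hNU hUo hUm using hU
  -- One measure of mass at most `ε` pays for the increments at all exceptional points: near a point
  -- of `N` with constant `k`, it dominates `k • μ`.
  set ν : Measure ℝ := Measure.sum fun k : ℕ => (k : ENNReal) • μ.restrict (U k) with hν
  have hνuniv : ν Set.univ ≤ ENNReal.ofReal ε := by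
    rw [hν, Measure.sum_apply _ MeasurableSet.univ]
    refine (ENNReal.tsum_le_tsum fun k => ?_).trans hδsum.le
    simpa using hUm k
  have : IsFiniteMeasure ν := ⟨hνuniv.trans_lt ENNReal.ofReal_lt_top⟩
  have hνreal : ∀ s, ν.real s ≤ ε := fun s =>
    ENNReal.toReal_le_of_le_ofReal hε.le ((measure_mono (Set.subset_univ s)).trans hνuniv)
  have hadd : ∀ t s, a ≤ t → t ≤ s →
      ν.real (Set.Ioc a s) = ν.real (Set.Ioc a t) + ν.real (Set.Ioc t s) := by
    intro t s h1 h2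
    rw [← Set.Ioc_union_Ioc_eq_Ioc h1 h2, measureReal_union (Set.Ioc_disjoint_Ioc_of_le le_rfl)
      measurableSet_Ioc]
  have key : ∀ t, a ≤ t → t ≤ b → u a ≤ u t + ν.real (Set.Ioc a t) + ε * (t - a) := by
    refine interval_induction (by simp) ?_ ?_
    · intro t hat htb hQ
      suffices h : ∀ᶠ s in 𝓝[>] t, u t ≤ u s + ν.real (Set.Ioc t s) + ε * (s - t) by
        filter_upwards [h, self_mem_nhdsWithin] with s hs hts
        rw [hadd t s hat (le_of_lt hts)]
        linarith
      by_cases htN : t ∈ N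
      · obtain ⟨k, hk⟩ := hinc t ⟨hat, htb⟩
        have hUk : ∀ᶠ s in 𝓝[>] t, Set.Ioc t s ⊆ U k := by
          obtain ⟨d, hd, hsub⟩ := Metric.isOpen_iff.1 (hUo k) t (hNU k htN)
          filter_upwards [mem_nhdsWithin_of_mem_nhds (Iio_mem_nhds (show t < t + d by linarith))]
            with s hs r hr
          refine hsub ?_
          rw [Metric.mem_ball, Real.dist_eq, abs_lt]
          constructor <;> linarith [hr.1, hr.2, Set.mem_Iio.1 hs]
        filter_upwards [hk, hUk, self_mem_nhdsWithin] with s hs hsU hts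
        have hle : (k : ℝ) * μ.real (Set.Ioc t s) ≤ ν.real (Set.Ioc t s) := by
          have : (k : ENNReal) * μ (Set.Ioc t s) ≤ ν (Set.Ioc t s) := by
            rw [hν, Measure.sum_apply _ measurableSet_Ioc]
            refine le_trans (le_of_eq ?_) (ENNReal.le_tsum k)
            simp [Measure.restrict_apply measurableSet_Ioc, Set.inter_eq_left.2 hsU]
          have := ENNReal.toReal_mono (measure_ne_top ν _) this
          simpa [Measure.real, ENNReal.toReal_mul] using this
        have h0 : 0 ≤ ε * (s - t) := mul_nonneg hε.le (sub_nonneg.2 (le_of_lt hts))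
        linarith [(abs_le.1 hs).1]
      · obtain ⟨c, hc, hd⟩ := not_not.1 htN ⟨hat, htb⟩
        have := (hasDerivAt_iff_isLittleO.1 hd).def hε
        filter_upwards [mem_nhdsWithin_of_mem_nhds this, self_mem_nhdsWithin] with s hs hts
        have hts' : 0 < s - t := sub_pos.2 hts
        rw [Real.norm_eq_abs, Real.norm_eq_abs, abs_of_pos hts', smul_eq_mul] at hs
        have := (abs_le.1 hs).1
        have h1 : 0 ≤ (s - t) * c := by positivity
        have h2 : 0 ≤ ν.real (Set.Ioc t s) := measureReal_nonneg
        linarith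
    -- At a left limit only monotonicity of `s ↦ ν (a, s]` is needed, so atoms of `ν` do no harm.
    · intro t hat htb hQ
      have hcont : Tendsto (fun s => u s + ν.real (Set.Ioc a t) + ε * (s - a)) (𝓝[<] t)
          (𝓝 (u t + ν.real (Set.Ioc a t) + ε * (t - a))) := by
        have h1 : Tendsto u (𝓝[<] t) (𝓝 (u t)) :=
          (hu t ⟨hat.le, htb⟩).mono_left (by
            rw [← nhdsWithin_Ioo_eq_nhdsLT hat]
            exact nhdsWithin_mono _ fun s hs => ⟨hs.1.le, hs.2.le.trans htb⟩)
        have h2 : Tendsto (fun s : ℝ => ε * (s - a)) (𝓝[<] t) (𝓝 (ε * (t - a))) :=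
          (Continuous.tendsto (by fun_prop) t).mono_left nhdsWithin_le_nhds
        exact (h1.add_const _).add h2
      refine ge_of_tendsto hcont ?_
      filter_upwards [Ioo_mem_nhdsLT hat] with s hs
      have := hQ s hs.1.le hs.2
      have h3 : ν.real (Set.Ioc a s) ≤ ν.real (Set.Ioc a t) :=
        measureReal_mono (Set.Ioc_subset_Ioc_right hs.2.le)
      linarith
  linarith [key b hab le_rfl, hνreal (Set.Ioc a b)]

/-! ### Absolutely continuous curves. -/

section Curve

variable {E : Type*} [NormedAddCommGroup E] [NormedSpace ℝ E] {z v : ℝ → E} {a b : ℝ}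

theorem sub_eq_integral_of_primitive
    (hv : ∀ t, 0 ≤ t → IntervalIntegrable v volume 0 t)
    (hz : ∀ t, 0 ≤ t → z t = z 0 + ∫ r in (0 : ℝ)..t, v r) {t s : ℝ} (ht : 0 ≤ t) (hs : 0 ≤ s) :
    z s - z t = ∫ r in t..s, v r := by
  rw [hz s hs, hz t ht, ← intervalIntegral.integral_interval_sub_left (hv s hs) (hv t ht)]
  abel

theorem continuousOn_of_primitive
    (hv : ∀ t, 0 ≤ t → IntervalIntegrable v volume 0 t)
    (hz : ∀ t, 0 ≤ t → z t = z 0 + ∫ r in (0 : ℝ)..t, v r) :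
    ContinuousOn z (Set.Ici 0) := by
  intro t ht
  have ht0 : (0 : ℝ) ≤ t := ht
  have h1 : ContinuousOn (fun s => ∫ r in (0 : ℝ)..s, v r) (Set.uIcc 0 (t + 1)) :=
    intervalIntegral.continuousOn_primitive_interval
      ((intervalIntegrable_iff' (by simp)).1 (hv (t + 1) (by linarith)))
  rw [Set.uIcc_of_le (by linarith)] at h1
  have h2 : ContinuousOn z (Set.Icc 0 (t + 1)) :=
    (continuousOn_const.add h1).congr fun s hs => hz s hs.1
  refine (h2 t ⟨ht0, by linarith⟩).mono_of_mem_nhdsWithin ?_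
  filter_upwards [self_mem_nhdsWithin,
    mem_nhdsWithin_of_mem_nhds (Iic_mem_nhds (show t < t + 1 by linarith))] with s h3 h4
    using ⟨h3, h4⟩

theorem ae_hasDerivAt_of_primitive [CompleteSpace E]
    (hv : ∀ t, 0 ≤ t → IntervalIntegrable v volume 0 t)
    (hz : ∀ t, 0 ≤ t → z t = z 0 + ∫ r in (0 : ℝ)..t, v r) :
    ∀ᵐ t, 0 < t → HasDerivAt z (v t) t := by
  -- Lebesgue differentiation works on bounded intervals; countably many of them cover the
  -- half-line.
  have h : ∀ n : ℕ, ∀ᵐ t, t ∈ Set.uIcc (0 : ℝ) n →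
      ∀ c ∈ Set.uIcc (0 : ℝ) n, HasDerivAt (fun x => ∫ r in c..x, v r) (v t) t := fun n =>
    (hv n n.cast_nonneg).ae_hasDerivAt_integral
  filter_upwards [ae_all_iff.2 h] with t ht h0
  obtain ⟨n, hn⟩ := exists_nat_gt t
  have h1 := ht n (by rw [Set.uIcc_of_le n.cast_nonneg]; exact ⟨h0.le, hn.le⟩) 0 (by simp)
  refine (h1.const_add (z 0)).congr_of_eventuallyEq ?_
  filter_upwards [Ioi_mem_nhds h0] with s hs using hz s (le_of_lt hs)

/-- A differentiable function increases along an absolutely continuous curve if its derivative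
along the curve is nonnegative almost everywhere. The function need not be locally Lipschitz. -/
theorem le_of_ae_fderiv_nonneg [CompleteSpace E]
    (hv : ∀ t, 0 ≤ t → IntervalIntegrable v volume 0 t)
    (hz : ∀ t, 0 ≤ t → z t = z 0 + ∫ r in (0 : ℝ)..t, v r)
    {g : E → ℝ} (hg : Differentiable ℝ g) (ha : 0 ≤ a) (hab : a ≤ b)
    (h : ∀ᵐ t, t ∈ Set.Ioo a b → 0 ≤ fderiv ℝ g (z t) (v t)) : g (z a) ≤ g (z b) := by
  have hvab : IntervalIntegrable v volume a b :=
    (hv a ha).symm.trans (hv b (ha.trans hab))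
  have hint : Integrable v (volume.restrict (Set.Ioc a b)) :=
    (intervalIntegrable_iff_integrableOn_Ioc_of_le hab).1 hvab
  -- The arc length measure of the curve: it bounds the increments of `z`, and Lebesgue null sets
  -- are null for it.
  set μ := (volume.restrict (Set.Ioc a b)).withDensity (fun r => ‖v r‖ₑ) with hμ
  have : IsFiniteMeasure μ := ⟨by
    rw [hμ, withDensity_apply _ MeasurableSet.univ, Measure.restrict_univ]
    exact hint.2⟩
  have hac : μ ≪ volume :=
    (withDensity_absolutelyContinuous _ _).trans Measure.absolutelyContinuous_restrict
  have hcont : ContinuousOn z (Set.Icc a b) :=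
    (continuousOn_of_primitive hv hz).mono fun t ht => ha.trans ht.1
  have hdist : ∀ t s, a ≤ t → t ≤ s → s ≤ b → ‖z s - z t‖ ≤ μ.real (Set.Ioc t s) := by
    intro t s h1 h2 h3
    rw [sub_eq_integral_of_primitive hv hz (ha.trans h1) (ha.trans (h1.trans h2)),
      intervalIntegral.integral_of_le h2]
    have hsub : Set.Ioc t s ⊆ Set.Ioc a b := Set.Ioc_subset_Ioc h1 h3
    refine (norm_integral_le_integral_norm _).trans (le_of_eq ?_)
    rw [Measure.real, hμ, withDensity_apply _ measurableSet_Ioc,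
      Measure.restrict_restrict measurableSet_Ioc, Set.inter_eq_left.2 hsub,
      integral_norm_eq_lintegral_enorm (hint.1.mono_measure (Measure.restrict_mono hsub le_rfl))]
  refine le_of_ae_deriv_nonneg_of_increment_le (u := fun t => g (z t)) hab
    (hg.continuous.comp_continuousOn hcont) μ (hac.ae_le ?_) ?_
  · have hne : ∀ᵐ t : ℝ, t ≠ a := by simp [ae_iff]
    filter_upwards [ae_hasDerivAt_of_primitive hv hz, h, hne] with t h1 h2 h3 h4
    have hat : a < t := lt_of_le_of_ne h4.1 (Ne.symm h3)
    exact ⟨_, h2 ⟨hat, h4.2⟩,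
      (hg (z t)).hasFDerivAt.comp_hasDerivAt t (h1 (ha.trans_lt hat))⟩
  · intro t ht
    -- Differentiability at the single point `z t` gives a linear bound there; `C` depends on `t`,
    -- hence the integer `k` chosen pointwise.
    obtain ⟨C, hC⟩ := (hg (z t)).hasFDerivAt.isBigO_sub.bound
    obtain ⟨k, hk⟩ := exists_nat_ge C
    refine ⟨k, ?_⟩
    have htend : Tendsto z (𝓝[>] t) (𝓝 (z t)) :=
      (hcont t ⟨ht.1, ht.2.le⟩).mono_left (by
        rw [← nhdsWithin_Ioo_eq_nhdsGT ht.2]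
        exact nhdsWithin_mono _ fun s hs => ⟨ht.1.trans hs.1.le, hs.2.le⟩)
    filter_upwards [htend.eventually hC, Ioo_mem_nhdsGT ht.2] with s hs hts
    calc |g (z s) - g (z t)| ≤ C * ‖z s - z t‖ := hs
      _ ≤ k * ‖z s - z t‖ := by gcongr
      _ ≤ k * μ.real (Set.Ioc t s) := by gcongr; exact hdist t s ht.1 hts.1.le hts.2.le

/-- An absolutely continuous curve whose speed is bounded by the distance from its initial point
does not move. -/
theorem eq_of_norm_le_mul_norm_sub
    (hv : ∀ t, 0 ≤ t → IntervalIntegrable v volume 0 t)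
    (hz : ∀ t, 0 ≤ t → z t = z 0 + ∫ r in (0 : ℝ)..t, v r) (ha : 0 ≤ a) (hab : a ≤ b) {K : ℝ}
    (hK : 0 ≤ K) (hKab : K * (b - a) < 1)
    (h : ∀ r ∈ Set.Ioo a b, ‖v r‖ ≤ K * ‖z r - z a‖) : ∀ s ∈ Set.Icc a b, z s = z a := by
  have hcont : ContinuousOn (fun s => ‖z s - z a‖) (Set.Icc a b) :=
    (((continuousOn_of_primitive hv hz).mono fun t ht => ha.trans ht.1).sub
      continuousOn_const).norm
  obtain ⟨c, hc, hmax⟩ := isCompact_Icc.exists_isMaxOn (Set.nonempty_Icc.2 hab) hcont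
  have hmax' : ∀ s ∈ Set.Icc a b, ‖z s - z a‖ ≤ ‖z c - z a‖ := fun s hs => hmax hs
  -- Integrating the speed up to the farthest point bounds the maximal distance by itself times a
  -- factor below one.
  have h1 : ‖z c - z a‖ ≤ K * ‖z c - z a‖ * |c - a| := by
    conv_lhs => rw [sub_eq_integral_of_primitive hv hz ha (ha.trans hc.1)]
    refine intervalIntegral.norm_integral_le_of_norm_le_const_ae ?_
    have hne : ∀ᵐ t : ℝ, t ≠ b := by simp [ae_iff]
    filter_upwards [hne] with r hrb hr
    rw [Set.uIoc_of_le hc.1] at hr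
    have hr' : r ∈ Set.Ioo a b := ⟨hr.1, lt_of_le_of_ne (hr.2.trans hc.2) hrb⟩
    exact (h r hr').trans (by gcongr; exact hmax' r ⟨hr'.1.le, hr'.2.le⟩)
  rw [abs_of_nonneg (sub_nonneg.2 hc.1)] at h1
  have h2 : K * (c - a) ≤ K * (b - a) := by gcongr; exact hc.2
  have h3 : ‖z c - z a‖ = 0 := by nlinarith [norm_nonneg (z c - z a)]
  intro s hs
  have := hmax' s hs
  rw [h3] at this
  exact sub_eq_zero.1 (norm_le_zero_iff.1 this)

theorem eq_of_ae_eq_zero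
    (hv : ∀ t, 0 ≤ t → IntervalIntegrable v volume 0 t)
    (hz : ∀ t, 0 ≤ t → z t = z 0 + ∫ r in (0 : ℝ)..t, v r) (ha : 0 ≤ a)
    (h : ∀ᵐ r, r ∈ Set.Ioo a b → v r = 0) : ∀ s, a ≤ s → s < b → z s = z a := by
  intro s has hsb
  rw [← sub_eq_zero, sub_eq_integral_of_primitive hv hz ha (ha.trans has)]
  refine intervalIntegral.integral_zero_ae ?_
  filter_upwards [h] with r hr hrs
  rw [Set.uIoc_of_le has] at hrs
  exact hr ⟨hrs.1, hrs.2.trans_lt hsb⟩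

end Curve

theorem fderiv_eq_gradVec_dotProduct {n : ℕ} (u : (Fin n → ℝ) → ℝ) (z w : Fin n → ℝ) :
    fderiv ℝ u z w = gradVec u z ⬝ᵥ w := by
  conv_lhs => rw [pi_eq_sum_univ' w, map_sum]
  refine Finset.sum_congr rfl fun j _ => ?_
  rw [map_smul, smul_eq_mul, mul_comm]
  rfl

/-! ### Linear algebra of the subsystems at a point. -/

namespace SwitchedProblem

variable {n m p : ℕ} {P : SwitchedProblem n m p} {A : Finset (Fin p)} {z : Fin n → ℝ}

theorem fderiv_f (z w : Fin n → ℝ) : fderiv ℝ P.f z w = P.gradf z ⬝ᵥ w :=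
  fderiv_eq_gradVec_dotProduct _ _ _

theorem fderiv_gineq (i : Fin p) (z w : Fin n → ℝ) :
    fderiv ℝ (fun x => P.gineq x i) z w = P.Jineq z i ⬝ᵥ w :=
  fderiv_eq_gradVec_dotProduct _ _ _

theorem Admissible.differentiable_gineq (hP : P.Admissible) (i : Fin p) :
    Differentiable ℝ (fun x => P.gineq x i) :=
  differentiable_pi.1 hP.diff_gineq i

theorem mem_idx {i : Fin p} : i ∈ P.idx z ↔ P.gineq z i = 0 := by
  simp [idx]

theorem idx_mem_indexSets (z : Fin n → ℝ) : P.idx z ∈ P.indexSets := ⟨z, Finset.Subset.refl _⟩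

theorem indexSets_of_subset {B : Finset (Fin p)} (hA : A ∈ P.indexSets) (h : B ⊆ A) :
    B ∈ P.indexSets :=
  let ⟨w, hw⟩ := hA
  ⟨w, h.trans hw⟩

/-- The combination of the constraint gradients with coefficients `lam` and `N`. -/
def gradComb (P : SwitchedProblem n m p) (z : Fin n → ℝ) (lam : Fin m → ℝ) (N : Fin p → ℝ) :
    Fin n → ℝ :=
  (P.Jeq z)ᵀ *ᵥ lam + (P.Jineq z)ᵀ *ᵥ N

/-- Extension by zero of a vector with indices in `A`. -/
def extendZero (A : Finset (Fin p)) (nu : {i // i ∈ A} → ℝ) : Fin p → ℝ :=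
  fun i => if hi : i ∈ A then nu ⟨i, hi⟩ else 0

theorem extendZero_coe (nu : {i // i ∈ A} → ℝ) (i : {i // i ∈ A}) : extendZero A nu i = nu i := by
  simp [extendZero]

theorem extendZero_of_notMem (nu : {i // i ∈ A} → ℝ) {i : Fin p} (hi : i ∉ A) :
    extendZero A nu i = 0 := by
  simp [extendZero, hi]

theorem JA_transpose_mulVec (lam : Fin m → ℝ) (nu : {i // i ∈ A} → ℝ) :
    (P.JA A z)ᵀ *ᵥ Sum.elim lam nu = P.gradComb z lam (extendZero A nu) := by
  ext j
  simp only [gradComb, mulVec, dotProduct, transpose_apply, JA, of_apply, Fintype.sum_sum_type,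
    Sum.elim_inl, Sum.elim_inr, Pi.add_apply]
  congr 1
  rw [← Finset.sum_subset (Finset.subset_univ A), ← Finset.sum_coe_sort A]
  · exact Finset.sum_congr rfl fun i _ => by rw [extendZero_coe]
  · intro i _ hi
    rw [extendZero_of_notMem nu hi, mul_zero]

theorem JA_transpose_mulVec_of_support (lam : Fin m → ℝ) {N : Fin p → ℝ}
    (hN : ∀ i, i ∉ A → N i = 0) :
    (P.JA A z)ᵀ *ᵥ Sum.elim lam (fun i => N i.1) = P.gradComb z lam N := by
  rw [JA_transpose_mulVec]
  congr 1
  ext i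
  by_cases hi : i ∈ A
  · simp [extendZero, hi]
  · simp [extendZero, hi, hN i hi]

theorem JA_mulVec (y : Fin n → ℝ) :
    P.JA A z *ᵥ y = Sum.elim (P.Jeq z *ᵥ y) (fun i => P.Jineq z i.1 ⬝ᵥ y) := by
  ext (i | i) <;> rfl

theorem AA_mulVec_gradf_add :
    P.AA A z *ᵥ P.gradf z + P.dA A = Sum.elim (P.geq z) (fun i => P.gineq z i.1) := by
  ext (i | i) <;> rfl

/-- Collecting `A_A ∇f + d_A = g_A` separates the part that drives the constraints to zero from the
projected gradient flow. -/
theorem h_eq (A : Finset (Fin p)) (z : Fin n → ℝ) :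
    P.h A z = -(P.κ₁ • (((P.AA A z)ᵀ * (P.BA A z)⁻¹) *ᵥ
        Sum.elim (P.geq z) (fun i => P.gineq z i.1)))
      - P.κ₂ • ((P.Gperp A z)ᵀ *ᵥ (P.Gperp A z *ᵥ P.gradf z)) := by
  rw [← AA_mulVec_gradf_add, h, add_mulVec, smul_mulVec, smul_mulVec, mulVec_add, smul_add,
    mulVec_mulVec, mulVec_mulVec]
  abel

theorem Admissible.isUnit_BA (hP : P.Admissible) (hA : A ∈ P.indexSets) (hz : z ∈ P.Gineq) :
    IsUnit (P.BA A z) := by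
  obtain ⟨_, _, _, _, h⟩ := hP.B_pos A hA
  exact (h z hz).1

theorem Admissible.Gperp_mulVec_JA_transpose (hP : P.Admissible) (hA : A ∈ P.indexSets)
    (hz : z ∈ P.Gineq) (x : Fin m ⊕ {i // i ∈ A} → ℝ) :
    P.Gperp A z *ᵥ ((P.JA A z)ᵀ *ᵥ x) = 0 := by
  rw [mulVec_mulVec, (hP.annihilator A hA z hz).1, zero_mulVec]

/-- The annihilator term drops out, and `A_Aᵀ B_A⁻¹` is a right inverse of the Jacobian. This is the
exponential decay law `ġ_A = -κ₁ g_A`. -/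
theorem Admissible.JA_mulVec_h (hP : P.Admissible) (hA : A ∈ P.indexSets) (hz : z ∈ P.Gineq) :
    P.JA A z *ᵥ P.h A z = -(P.κ₁ • Sum.elim (P.geq z) (fun i => P.gineq z i.1)) := by
  have h1 : P.JA A z * (P.Gperp A z)ᵀ = 0 := by
    have := congrArg transpose (hP.annihilator A hA z hz).1
    simpa [transpose_mul] using this
  have h2 : P.JA A z * ((P.AA A z)ᵀ * (P.BA A z)⁻¹) = 1 := by
    rw [← Matrix.mul_assoc]
    exact mul_nonsing_inv _ ((isUnit_iff_isUnit_det _).1 (hP.isUnit_BA hA hz))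
  rw [h_eq, mulVec_sub, mulVec_neg, mulVec_smul, mulVec_smul, mulVec_mulVec, mulVec_mulVec, h2, h1]
  simp

theorem Admissible.Jineq_dotProduct_h (hP : P.Admissible) (hA : A ∈ P.indexSets)
    (hz : z ∈ P.Gineq) {i : Fin p} (hi : i ∈ A) :
    P.Jineq z i ⬝ᵥ P.h A z = -(P.κ₁ * P.gineq z i) := by
  have := congrFun (hP.JA_mulVec_h hA hz) (Sum.inr ⟨i, hi⟩)
  rwa [JA_mulVec] at this

/-- Transposing `B_A B_A⁻¹ = 1` exhibits a left inverse. -/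
theorem Admissible.JA_transpose_injective (hP : P.Admissible) (hA : A ∈ P.indexSets)
    (hz : z ∈ P.Gineq) : Function.Injective ((P.JA A z)ᵀ).mulVec := by
  have hdet := (isUnit_iff_isUnit_det _).1 (hP.isUnit_BA hA hz)
  have h1 : ((P.BA A z)⁻¹)ᵀ * (P.AA A z) * (P.JA A z)ᵀ = 1 := by
    have := congrArg transpose (mul_nonsing_inv _ hdet)
    rw [transpose_mul, transpose_one] at this
    rw [Matrix.mul_assoc, ← this, BA, transpose_mul, transpose_transpose]
  intro x y hxy
  have := congrArg (fun w => (((P.BA A z)⁻¹)ᵀ * (P.AA A z)) *ᵥ w) hxy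
  simpa only [mulVec_mulVec, h1, one_mulVec] using this

/-- The kernel of `G_A^⊥` is the span of the gradients of the constraints in `A`. -/
theorem Admissible.exists_of_Gperp_mulVec_eq_zero (hP : P.Admissible) (hA : A ∈ P.indexSets)
    (hz : z ∈ P.Gineq) {y : Fin n → ℝ} (hy : P.Gperp A z *ᵥ y = 0) :
    ∃ x, (P.JA A z)ᵀ *ᵥ x = y := by
  have hinj : Function.Injective ((P.JA A z)ᵀ).mulVecLin := hP.JA_transpose_injective hA hz
  have hle : LinearMap.range ((P.JA A z)ᵀ).mulVecLin ≤ LinearMap.ker (P.Gperp A z).mulVecLin := by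
    rintro _ ⟨x, rfl⟩
    exact hP.Gperp_mulVec_JA_transpose hA hz x
  have h1 : Module.finrank ℝ (LinearMap.range ((P.JA A z)ᵀ).mulVecLin) = m + A.card := by
    rw [LinearMap.finrank_range_of_inj hinj]
    simp
  have h2 := LinearMap.finrank_range_add_finrank_ker (P.Gperp A z).mulVecLin
  have h3 : Module.finrank ℝ (LinearMap.range (P.Gperp A z).mulVecLin) = n - m - A.card :=
    (hP.annihilator A hA z hz).2
  have h4 := Submodule.finrank_le (LinearMap.range ((P.JA A z)ᵀ).mulVecLin)
  rw [Module.finrank_fin_fun] at h2 h4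
  -- By `h4`, `m + A.card ≤ n`, so the truncated subtraction in the rank condition is a genuine one.
  have heq := Submodule.eq_of_le_of_finrank_eq hle (by omega)
  have hmem : y ∈ LinearMap.ker (P.Gperp A z).mulVecLin := hy
  rw [← heq] at hmem
  exact hmem

theorem Admissible.Gperp_mulVec_gradComb (hP : P.Admissible) (hA : A ∈ P.indexSets)
    (hz : z ∈ P.Gineq) (lam : Fin m → ℝ) {N : Fin p → ℝ} (hN : ∀ i, i ∉ A → N i = 0) :
    P.Gperp A z *ᵥ P.gradComb z lam N = 0 := by
  rw [← JA_transpose_mulVec_of_support lam hN]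
  exact hP.Gperp_mulVec_JA_transpose hA hz _

/-- The gradients of the constraints in `A` are linearly independent. -/
theorem Admissible.eq_zero_of_gradComb_eq_zero (hP : P.Admissible) (hA : A ∈ P.indexSets)
    (hz : z ∈ P.Gineq) {lam : Fin m → ℝ} {N : Fin p → ℝ} (hN : ∀ i, i ∉ A → N i = 0)
    (h : P.gradComb z lam N = 0) : N = 0 := by
  rw [← JA_transpose_mulVec_of_support lam hN] at h
  have h1 := hP.JA_transpose_injective hA hz
    (h.trans (mulVec_zero ((P.JA A z)ᵀ)).symm)
  ext i
  by_cases hi : i ∈ A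
  · exact congrFun h1 (Sum.inr ⟨i, hi⟩)
  · exact hN i hi

/-! ### Lagrange multipliers and equilibria. -/

/-- `lam` and `N` are Lagrange multipliers at `z`, and only constraints in `A` contribute. -/
def IsFullMultiplier (P : SwitchedProblem n m p) (A : Finset (Fin p)) (z : Fin n → ℝ)
    (lam : Fin m → ℝ) (N : Fin p → ℝ) : Prop :=
  (∀ i, i ∉ A → N i = 0) ∧ P.gradf z + P.gradComb z lam N = 0

theorem IsMultiplier.isFullMultiplier {lam : Fin m → ℝ} {nu : {i // i ∈ A} → ℝ}
    (h : P.IsMultiplier A z lam nu) : P.IsFullMultiplier A z lam (extendZero A nu) := by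
  refine ⟨fun i hi => extendZero_of_notMem nu hi, ?_⟩
  rwa [IsMultiplier, JA_transpose_mulVec] at h

theorem IsFullMultiplier.mono {B : Finset (Fin p)} {lam : Fin m → ℝ} {N : Fin p → ℝ}
    (h : P.IsFullMultiplier A z lam N) (hAB : A ⊆ B) : P.IsFullMultiplier B z lam N :=
  ⟨fun i hi => h.1 i fun hA => hi (hAB hA), h.2⟩

theorem Admissible.exists_isFullMultiplier (hP : P.Admissible) (hA : A ∈ P.indexSets)
    (hz : z ∈ P.Gineq) (hG : P.Gperp A z *ᵥ P.gradf z = 0) :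
    ∃ lam N, P.IsFullMultiplier A z lam N := by
  obtain ⟨x, hx⟩ := hP.exists_of_Gperp_mulVec_eq_zero hA hz hG
  refine ⟨fun i => (-x) (Sum.inl i), extendZero A fun i => (-x) (Sum.inr i),
    fun i hi => extendZero_of_notMem _ hi, ?_⟩
  rw [← JA_transpose_mulVec]
  have : Sum.elim (fun i => (-x) (Sum.inl i)) (fun i => (-x) (Sum.inr i)) = -x := by
    ext (i | i) <;> rfl
  rw [this, mulVec_neg, hx, add_neg_cancel]

theorem IsFullMultiplier.Gperp_mulVec_gradf {lam : Fin m → ℝ} {N : Fin p → ℝ}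
    (h : P.IsFullMultiplier A z lam N) (hP : P.Admissible) (hA : A ∈ P.indexSets)
    (hz : z ∈ P.Gineq) : P.Gperp A z *ᵥ P.gradf z = 0 := by
  rw [eq_neg_of_add_eq_zero_left h.2, mulVec_neg, hP.Gperp_mulVec_gradComb hA hz lam h.1, neg_zero]

theorem h_of_active (hgeq : P.geq z = 0) (hA : A ⊆ P.idx z) :
    P.h A z = -(P.κ₂ • ((P.Gperp A z)ᵀ *ᵥ (P.Gperp A z *ᵥ P.gradf z))) := by
  have : Sum.elim (P.geq z) (fun i : {i // i ∈ A} => P.gineq z i.1) = 0 := by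
    ext (i | i)
    · exact congrFun hgeq i
    · exact mem_idx.1 (hA i.2)
  rw [h_eq, this]
  simp

theorem dotProduct_transpose_mulVec {k : ℕ} (G : Matrix (Fin k) (Fin n) ℝ) (x : Fin n → ℝ)
    (y : Fin k → ℝ) : x ⬝ᵥ (Gᵀ *ᵥ y) = (G *ᵥ x) ⬝ᵥ y := by
  rw [dotProduct_mulVec, vecMul_transpose]

theorem gradf_dotProduct_h (hgeq : P.geq z = 0) (hA : A ⊆ P.idx z) :
    P.gradf z ⬝ᵥ P.h A z =
      -(P.κ₂ * ((P.Gperp A z *ᵥ P.gradf z) ⬝ᵥ (P.Gperp A z *ᵥ P.gradf z))) := by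
  rw [h_of_active hgeq hA, dotProduct_neg, dotProduct_smul, dotProduct_transpose_mulVec,
    smul_eq_mul]

/-- The equilibria of a subsystem. -/
theorem Admissible.equilibrium (hP : P.Admissible) (hA : A ∈ P.indexSets) (hz : z ∈ P.Gineq)
    (h0 : P.h A z = 0) :
    P.geq z = 0 ∧ A ⊆ P.idx z ∧ P.Gperp A z *ᵥ P.gradf z = 0 := by
  have h1 := hP.JA_mulVec_h hA hz
  rw [h0, mulVec_zero, eq_comm, neg_eq_zero, smul_eq_zero, or_iff_right hP.κ₁_pos.ne'] at h1
  have hgeq : P.geq z = 0 := by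
    ext i
    exact congrFun h1 (Sum.inl i)
  have hsub : A ⊆ P.idx z := fun i hi => mem_idx.2 (congrFun h1 (Sum.inr ⟨i, hi⟩))
  refine ⟨hgeq, hsub, ?_⟩
  -- With `g_A = 0`, the derivative of `f` along `h_A` is `-κ₂ ‖G_A^⊥ ∇f‖²`, which must vanish at an
  -- equilibrium.
  have h2 := gradf_dotProduct_h hgeq hsub
  rw [h0, dotProduct_zero, eq_comm, neg_eq_zero, mul_eq_zero, or_iff_right hP.κ₂_pos.ne'] at h2
  exact dotProduct_self_eq_zero.1 h2

theorem IsFullMultiplier.h_eq_zero {lam : Fin m → ℝ} {N : Fin p → ℝ}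
    (h : P.IsFullMultiplier A z lam N) (hP : P.Admissible) (hz : z ∈ P.Gineq)
    (hgeq : P.geq z = 0) (hA : A ⊆ P.idx z) : P.h A z = 0 := by
  rw [h_of_active hgeq hA,
    h.Gperp_mulVec_gradf hP (indexSets_of_subset (idx_mem_indexSets z) hA) hz]
  simp

/-- The derivatives of the constraint `k` and of the objective function along the subsystem that
results from the removal of `k`. -/
theorem IsFullMultiplier.derivatives_of_removal {lam : Fin m → ℝ} {N : Fin p → ℝ}
    (h : P.IsFullMultiplier A z lam N) (hP : P.Admissible) (hz : z ∈ P.Gineq)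
    (hgeq : P.geq z = 0) (hA : A ⊆ P.idx z) {k : Fin p} (hk : k ∈ A) :
    ∃ c : ℝ, 0 < c ∧ P.Jineq z k ⬝ᵥ P.h (A \ {k}) z = c * N k ∧
      P.gradf z ⬝ᵥ P.h (A \ {k}) z = -(c * N k ^ 2) := by
  have hAS : A ∈ P.indexSets := indexSets_of_subset (idx_mem_indexSets z) hA
  have hsub : A \ {k} ⊆ A := Finset.sdiff_subset
  have hA' : A \ {k} ∈ P.indexSets := indexSets_of_subset hAS hsub
  set G := P.Gperp (A \ {k}) z with hG
  -- Otherwise the gradient of constraint `k` would be a combination of those of the remaining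
  -- constraints, against linear independence over `A`.
  have hne : G *ᵥ P.Jineq z k ≠ 0 := by
    intro h0
    obtain ⟨x, hx⟩ := hP.exists_of_Gperp_mulVec_eq_zero hA' hz h0
    have hx' : Sum.elim (fun i => x (Sum.inl i)) (fun i => x (Sum.inr i)) = x := by
      ext (i | i) <;> rfl
    rw [← hx', JA_transpose_mulVec] at hx
    set N' := extendZero (A \ {k}) fun i => x (Sum.inr i) with hN'
    have hzero : P.gradComb z (fun i => x (Sum.inl i)) (N' - Pi.single k 1) = 0 := by
      rw [gradComb, mulVec_sub, mulVec_single_one, ← add_sub_assoc, sub_eq_zero]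
      exact hx
    have := hP.eq_zero_of_gradComb_eq_zero hAS hz (fun i hi => ?_) hzero
    · have := congrFun this k
      rw [Pi.sub_apply, hN', extendZero_of_notMem _ (by simp)] at this
      simp at this
    · have hik : i ≠ k := fun e => hi (e ▸ hk)
      rw [Pi.sub_apply, hN', extendZero_of_notMem _ (fun h' => hi (hsub h'))]
      simp [hik]
  -- `G` annihilates every term of the multiplier equation except that of `k`.
  have hgrad : G *ᵥ P.gradf z = -(N k • (G *ᵥ P.Jineq z k)) := by
    have h1 : P.gradComb z lam N = P.gradComb z lam (Function.update N k 0)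
        + N k • P.Jineq z k := by
      have : N = Function.update N k 0 + N k • Pi.single k (1 : ℝ) := by
        ext i
        by_cases hik : i = k
        · subst hik; simp
        · simp [hik]
      conv_lhs => rw [this]
      rw [gradComb, gradComb, mulVec_add, mulVec_smul, mulVec_single_one, add_assoc]
      rfl
    have h2 : G *ᵥ P.gradComb z lam (Function.update N k 0) = 0 := by
      refine hP.Gperp_mulVec_gradComb hA' hz lam fun i hi => ?_
      by_cases hik : i = k
      · subst hik; simp
      · rw [Function.update_of_ne hik]
        exact h.1 i fun hiA => hi (by simp [hiA, hik])
    rw [eq_neg_of_add_eq_zero_left h.2, mulVec_neg, h1, mulVec_add, h2, zero_add, mulVec_smul]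
  have hpos : 0 < (G *ᵥ P.Jineq z k) ⬝ᵥ (G *ᵥ P.Jineq z k) :=
    lt_of_le_of_ne (Finset.sum_nonneg fun i _ => mul_self_nonneg _)
      (Ne.symm (mt dotProduct_self_eq_zero.1 hne))
  refine ⟨P.κ₂ * ((G *ᵥ P.Jineq z k) ⬝ᵥ (G *ᵥ P.Jineq z k)), mul_pos hP.κ₂_pos hpos, ?_, ?_⟩
  · rw [h_of_active hgeq (hsub.trans hA), dotProduct_neg, dotProduct_smul,
      dotProduct_transpose_mulVec, ← hG, hgrad]
    simp only [dotProduct_neg, dotProduct_smul, smul_eq_mul]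
    ring
  · rw [gradf_dotProduct_h hgeq (hsub.trans hA), ← hG, hgrad]
    simp only [dotProduct_neg, neg_dotProduct, dotProduct_smul, smul_dotProduct, smul_eq_mul]
    ring

theorem IsFullMultiplier.kkt {lam : Fin m → ℝ} {N : Fin p → ℝ}
    (h : P.IsFullMultiplier (P.idx z) z lam N) (hz : z ∈ P.Gineq) (hgeq : P.geq z = 0)
    (hN : ∀ i, 0 ≤ N i) : P.KKT z := by
  refine ⟨lam, N, ?_, hgeq, hz, hN, fun i => ?_⟩
  · rw [add_assoc]
    exact h.2
  · by_cases hi : i ∈ P.idx z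
    · rw [mem_idx.1 hi, mul_zero]
    · rw [h.1 i hi, zero_mul]

/-! The switching law at a single point. -/

theorem addIdx_subset_idx (z : Fin n → ℝ) (s : Finset (Fin p)) : P.addIdx z s ⊆ P.idx z :=
  fun _ hi => (Finset.mem_sdiff.1 (Finset.mem_filter.1 hi).1).1

theorem mem_union_addIdx {s : Finset (Fin p)} {i : Fin p} (hi : i ∈ P.idx z)
    (h : 0 ≤ P.Jineq z i ⬝ᵥ P.h s z) : i ∈ s ∪ P.addIdx z s := by
  classical
  by_cases his : i ∈ s
  · exact Finset.mem_union_left _ his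
  · exact Finset.mem_union_right _ (Finset.mem_filter.2 ⟨Finset.mem_sdiff.2 ⟨hi, his⟩, h⟩)

/-- The test for adding is a non-strict inequality, so a zero velocity lets every active constraint
pass. -/
theorem union_addIdx_of_h_eq_zero (hA : A ⊆ P.idx z) (h0 : P.h A z = 0) :
    A ∪ P.addIdx z A = P.idx z := by
  refine Finset.Subset.antisymm (Finset.union_subset hA (addIdx_subset_idx z A)) fun i hi => ?_
  exact mem_union_addIdx hi (by rw [h0, dotProduct_zero])

theorem IsFullMultiplier.removable_iff {lam : Fin m → ℝ} {N : Fin p → ℝ}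
    (h : P.IsFullMultiplier A z lam N) (hP : P.Admissible) (hz : z ∈ P.Gineq)
    (hgeq : P.geq z = 0) (hA : A ⊆ P.idx z) {t τ : ℝ} {k : Fin p} :
    P.Removable t z A τ k ↔ k ∈ A ∧ N k < 0 ∧ τ + P.δT < t := by
  refine and_congr_right fun hk => and_congr_left fun _ => ?_
  obtain ⟨c, hc, h1, _⟩ := h.derivatives_of_removal hP hz hgeq hA hk
  rw [h1, mul_neg_iff]
  exact ⟨fun h' => h'.elim (fun h' => h'.2) fun h' => absurd h'.1 hc.not_gt,
    fun h' => Or.inl ⟨hc, h'⟩⟩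

theorem IsFullMultiplier.not_removable {lam : Fin m → ℝ} {N : Fin p → ℝ}
    (h : P.IsFullMultiplier A z lam N) (hP : P.Admissible) (hz : z ∈ P.Gineq)
    (hgeq : P.geq z = 0) (hA : A ⊆ P.idx z) (hN : ∀ i, 0 ≤ N i) (t τ : ℝ) (k : Fin p) :
    ¬ P.Removable t z A τ k := by
  rw [h.removable_iff hP hz hgeq hA]
  exact fun h' => absurd h'.2.1 (hN k).not_gt

theorem IsFullMultiplier.lawStep_iff {lam : Fin m → ℝ} {N : Fin p → ℝ}
    (h : P.IsFullMultiplier A z lam N) (hP : P.Admissible) (hz : z ∈ P.Gineq)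
    (hgeq : P.geq z = 0) (hA : A ⊆ P.idx z) (hN : ∀ i, 0 ≤ N i) (t τ : ℝ)
    (s' : Finset (Fin p)) (τ' : ℝ) :
    P.LawStep t z A τ s' τ' ↔ s' = P.idx z ∧ τ' = τ := by
  have hno := h.not_removable hP hz hgeq hA hN t τ
  rw [LawStep, union_addIdx_of_h_eq_zero hA (h.h_eq_zero hP hz hgeq hA)]
  exact ⟨fun h' => h'.elim (fun h' => h'.2) fun ⟨k, hk, _⟩ => absurd hk (hno k),
    fun h' => Or.inl ⟨hno, h'⟩⟩

/-! Trajectories. -/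

variable {y : ℝ → Fin n → ℝ} {σ : ℝ → Finset (Fin p)} {T : ℝ → ℝ}

/-- If the active set does not change immediately after the time `r`, then the switching law
neither adds nor removes a constraint at the time `r`. -/
theorem IsRun.no_switch (hr : P.IsRun P.DelayedStep y σ T) {r : ℝ} (h0 : 0 ≤ r)
    (hσ : ∀ᶠ x in 𝓝[>] r, σ x = σ r) :
    σ r ∪ P.addIdx (y r) (σ r) = σ r ∧ ∀ᶠ x in 𝓝[>] r, T x = T r := by
  obtain ⟨s', τ', hstep, hev⟩ := hr.update r h0
  obtain ⟨x, hx1, hx2⟩ := (hσ.and hev).exists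
  have hs : s' = σ r := hx2.1.symm.trans hx1
  rcases hstep with ⟨h1, h2⟩ | ⟨k, hk, h1, _⟩
  · exact ⟨h1.symm.trans hs, hev.mono fun x hx => hx.2.trans h2⟩
  · rw [hs] at h1
    have := hk.1
    rw [h1] at this
    simp at this

theorem IsRun.exists_const_right (hr : P.IsRun P.DelayedStep y σ T) {t : ℝ} (h0 : 0 ≤ t) :
    ∃ s' τ', P.DelayedStep t (y t) (σ t) (T t) s' τ' ∧
      ∃ d, t < d ∧ ∀ r ∈ Set.Ioo t d, σ r = s' := by
  obtain ⟨s', τ', hstep, hev⟩ := hr.update t h0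
  obtain ⟨d, hd, hsub⟩ := mem_nhdsGT_iff_exists_Ioo_subset.1 hev
  exact ⟨s', τ', hstep, d, hd, fun r hr => (hsub hr).1⟩

theorem IsRun.exists_const_left (hr : P.IsRun P.DelayedStep y σ T) {t a : ℝ} (h0 : 0 < t)
    (ha : a < t) :
    ∃ c, a ≤ c ∧ c < t ∧ ∀ r ∈ Set.Ioo c t, σ r = σ t ∧ T r = T t := by
  obtain ⟨c, hc, hsub⟩ := (mem_nhdsLT_iff_exists_Ioo_subset' ha).1 (hr.left t h0)
  exact ⟨max c a, le_max_right _ _, max_lt hc ha,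
    fun r hr => hsub ⟨(le_max_left _ _).trans_lt hr.1, hr.2⟩⟩

theorem eventually_eq_of_Ioo {s : Finset (Fin p)} {t d r : ℝ} (h : ∀ x ∈ Set.Ioo t d, σ x = s)
    (hr : r ∈ Set.Ioo t d) : ∀ᶠ x in 𝓝[>] r, σ x = σ r := by
  filter_upwards [Ioo_mem_nhdsGT hr.2] with x hx
  rw [h x ⟨hr.1.trans hx.1, hx.2⟩, h r hr]

theorem IsRun.tendsto_left (hr : P.IsRun P.DelayedStep y σ T) {t : ℝ} (h0 : 0 < t) :
    Tendsto y (𝓝[<] t) (𝓝 (y t)) :=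
  (continuousOn_of_primitive hr.integrable hr.solution t h0.le).mono_left (by
    rw [← nhdsWithin_Ioo_eq_nhdsLT h0]
    exact nhdsWithin_mono _ fun s hs => hs.1.le)

theorem IsRun.tendsto_right (hr : P.IsRun P.DelayedStep y σ T) {t : ℝ} (h0 : 0 ≤ t) :
    Tendsto y (𝓝[>] t) (𝓝 (y t)) :=
  (continuousOn_of_primitive hr.integrable hr.solution t h0).mono_left
    (nhdsWithin_mono _ fun _ hs => h0.trans (le_of_lt hs))

theorem IsRun.eq_of_eq_left (hr : P.IsRun P.DelayedStep y σ T) {t a : ℝ} (h0 : 0 < t) (ha : a < t)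
    (h : ∀ s, a ≤ s → s < t → y s = z) : y t = z := by
  refine tendsto_nhds_unique (hr.tendsto_left h0) (tendsto_const_nhds.congr' ?_)
  filter_upwards [Ioo_mem_nhdsLT ha] with s hs using (h s hs.1.le hs.2).symm

/-- Along a trajectory that rests at `z`, all active constraints are in the active set. -/
theorem IsRun.active_set_of_rest (hr : P.IsRun P.DelayedStep y σ T) (hP : P.Admissible)
    (hz : z ∈ P.Gineq) (hy : ∀ t, 0 ≤ t → y t = z) :
    ∀ t, 0 < t → σ t = P.idx z ∧ P.h (σ t) z = 0 := by
  have hae : ∀ᵐ r : ℝ, 0 < r → P.h (σ r) z = 0 := by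
    filter_upwards [ae_hasDerivAt_of_primitive hr.integrable hr.solution] with r h1 h0
    have h2 : HasDerivAt y 0 r := (hasDerivAt_const r z).congr_of_eventuallyEq (by
      filter_upwards [Ioi_mem_nhds h0] with s hs using hy s (le_of_lt hs))
    rw [← (h1 h0).unique h2, hy r h0.le]
  have hzero : ∀ t, 0 < t → P.h (σ t) z = 0 := by
    intro t ht
    obtain ⟨c, hc, hct, hconst⟩ := hr.exists_const_left ht ht
    obtain ⟨r, hr1, hr2⟩ := (Measure.dense_of_ae hae).exists_between hct
    rw [← (hconst r hr2).1]
    exact hr1 (hc.trans_lt hr2.1)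
  have hright : ∀ t, 0 ≤ t → ∃ d, t < d ∧ ∀ r ∈ Set.Ioo t d, σ r = P.idx z := by
    intro t ht
    obtain ⟨s', τ', _, d, hd, hconst⟩ := hr.exists_const_right ht
    obtain ⟨r, hr1⟩ := exists_between hd
    have h0 : 0 < r := ht.trans_lt hr1.1
    have h1 := (hr.no_switch h0.le (eventually_eq_of_Ioo hconst hr1)).1
    rw [hy r h0.le, union_addIdx_of_h_eq_zero
      (hP.equilibrium (hr.mem r h0.le) hz (hzero r h0)).2.1 (hzero r h0), hconst r hr1] at h1
    exact ⟨d, hd, fun x hx => (hconst x hx).trans h1.symm⟩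
  intro t ht
  refine ⟨?_, hzero t ht⟩
  obtain ⟨c, hc, hct, hconst⟩ := hr.exists_const_left ht ht
  obtain ⟨d, hd, hd'⟩ := hright c hc
  obtain ⟨r, hr1⟩ := exists_between (lt_min hct hd)
  rw [← (hconst r ⟨hr1.1, hr1.2.trans_le (min_le_left _ _)⟩).1]
  exact hd' r ⟨hr1.1, hr1.2.trans_le (min_le_right _ _)⟩

/-- A trajectory that does not ignore removals forever can rest only at points with nonnegative
multipliers. -/
theorem IsRun.multiplier_nonneg_of_rest (hr : P.IsRun P.DelayedStep y σ T) (hP : P.Admissible)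
    (hfreq : ∀ k, ∃ᶠ t in atTop, ¬ P.Removable t (y t) (σ t) (T t) k)
    (hz : z ∈ P.Gineq) (hy : ∀ t, 0 ≤ t → y t = z) {lam : Fin m → ℝ} {N : Fin p → ℝ}
    (hN : P.IsFullMultiplier (P.idx z) z lam N) (k : Fin p) : 0 ≤ N k := by
  have hrest := hr.active_set_of_rest hP hz hy
  have hgeq : P.geq z = 0 :=
    (hP.equilibrium (hr.mem 1 zero_le_one) hz (hrest 1 one_pos).2).1
  have hT : ∀ t, 1 ≤ t → T t = T 1 := by
    intro b hb
    refine interval_induction (Q := fun t => T t = T 1) rfl ?_ ?_ b hb le_rfl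
    · intro t h1 _ hQ
      have h0 : 0 < t := one_pos.trans_le h1
      refine (hr.no_switch h0.le ?_).2.mono fun x hx => hx.trans hQ
      filter_upwards [self_mem_nhdsWithin] with x hx
      rw [(hrest t h0).1, (hrest x (h0.trans hx)).1]
    · intro t h1 _ hQ
      obtain ⟨c, hc, hct, hconst⟩ := hr.exists_const_left (one_pos.trans h1) h1
      obtain ⟨r, hr1⟩ := exists_between hct
      rw [← (hconst r hr1).2]
      exact hQ r (hc.trans hr1.1.le) hr1.2
  by_contra! hk
  have hkidx : k ∈ P.idx z := by
    by_contra hki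
    exact hk.ne (hN.1 k hki)
  refine hfreq k ?_
  filter_upwards [eventually_ge_atTop 1, eventually_gt_atTop (T 1 + P.δT)] with t h1 h2
  have h0 : 0 < t := one_pos.trans_le h1
  rw [not_not, hy t h0.le, (hrest t h0).1, hT t h1,
    hN.removable_iff hP hz hgeq (Finset.Subset.refl _)]
  exact ⟨hkidx, hk, h2⟩

theorem Admissible.exists_multiplier_of_mem_Omega (hP : P.Admissible) {c : ℝ}
    (hz : z ∈ P.Omega c) : ∃ lam N, P.IsFullMultiplier (P.idx z) z lam N := by
  obtain ⟨_, ⟨hzI, _⟩, A, hA, hAz, hG⟩ := hz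
  obtain ⟨lam, N, h⟩ := hP.exists_isFullMultiplier hA hzI hG
  exact ⟨lam, N, h.mono hAz⟩

theorem Admissible.h_idx_of_mem_Omega (hP : P.Admissible) {c : ℝ} (hz : z ∈ P.Omega c) :
    P.h (P.idx z) z = 0 := by
  obtain ⟨lam, N, h⟩ := hP.exists_multiplier_of_mem_Omega hz
  exact h.h_eq_zero hP hz.2.1.1 hz.2.1.2 (Finset.Subset.refl _)

theorem IsRun.eq_of_const_of_mem_Omega (hr : P.IsRun P.DelayedStep y σ T) (hP : P.Admissible)
    {c : ℝ} (hΩ : ∀ t, 0 ≤ t → y t ∈ P.Omega c) {t d : ℝ} (h0 : 0 ≤ t) {s : Finset (Fin p)}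
    (hσ : ∀ r ∈ Set.Ioo t d, σ r = s) (hs : s ⊆ P.idx (y t)) :
    ∀ r, t ≤ r → r < d → y r = y t := by
  have hfeas : ∀ r, t ≤ r → y r ∈ P.Gineq := fun r h => (hΩ r (h0.trans h)).2.1.1
  have hsub : ∀ r ∈ Set.Ioo t d, s ⊆ P.idx (y r) := by
    intro r hr1 i hi
    have hsS : s ∈ P.indexSets := hσ r hr1 ▸ hr.mem r (h0.trans hr1.1.le)
    have hle := le_of_ae_fderiv_nonneg hr.integrable hr.solution (hP.differentiable_gineq i) h0
      hr1.1.le (Eventually.of_forall fun x hx => by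
        rw [hσ x ⟨hx.1, hx.2.trans hr1.2⟩, fderiv_gineq,
          hP.Jineq_dotProduct_h hsS (hfeas x hx.1.le) hi, neg_nonneg]
        exact mul_nonpos_of_nonneg_of_nonpos hP.κ₁_pos.le (hfeas x hx.1.le i))
    rw [mem_idx.1 (hs hi)] at hle
    exact mem_idx.2 (le_antisymm (hfeas r hr1.1.le i) hle)
  refine eq_of_ae_eq_zero hr.integrable hr.solution h0 ?_
  filter_upwards [ae_hasDerivAt_of_primitive hr.integrable hr.solution] with r hderiv hr1
  have hr0 : 0 < r := h0.trans_lt hr1.1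
  have hmax : ∀ i ∈ P.idx (y r), P.Jineq (y r) i ⬝ᵥ P.h (σ r) (y r) = 0 := by
    intro i hi
    have hd := ((hP.differentiable_gineq i) (y r)).hasFDerivAt.comp_hasDerivAt r (hderiv hr0)
    rw [fderiv_gineq] at hd
    refine IsLocalMax.hasDerivAt_eq_zero ?_ hd
    filter_upwards [Ioi_mem_nhds hr1.1] with x hx
    have h1 : P.gineq (y x) i ≤ 0 := hfeas x (le_of_lt hx) i
    have h2 : P.gineq (y r) i = 0 := mem_idx.1 hi
    exact h1.trans_eq h2.symm
  have hidx : P.idx (y r) = σ r := by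
    refine Finset.Subset.antisymm (fun i hi => ?_) (hσ r hr1 ▸ hsub r hr1)
    rw [← (hr.no_switch hr0.le (eventually_eq_of_Ioo hσ hr1)).1]
    exact mem_union_addIdx hi (hmax i hi).ge
  rw [← hidx]
  exact hP.h_idx_of_mem_Omega (hΩ r hr0.le)

/-- A trajectory that remains in `Ω` rests at its initial point. -/
theorem IsRun.rest_of_mem_Omega (hr : P.IsRun P.DelayedStep y σ T) (hP : P.Admissible)
    (hσ0 : σ 0 ⊆ P.idx (y 0)) {c : ℝ} (hΩ : ∀ t, 0 ≤ t → y t ∈ P.Omega c) :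
    ∀ t, 0 ≤ t → y t = y 0 := by
  intro b hb
  refine (interval_induction (Q := fun t => y t = y 0 ∧ σ t ⊆ P.idx (y 0)) ⟨rfl, hσ0⟩ ?_ ?_ b hb
    le_rfl).1
  · rintro t h0 - ⟨hyt, hσt⟩
    obtain ⟨s', τ', hstep, d, hd, hconst⟩ := hr.exists_const_right h0
    have hs' : s' ⊆ P.idx (y t) := by
      have hu : σ t ∪ P.addIdx (y t) (σ t) ⊆ P.idx (y t) :=
        Finset.union_subset (hyt ▸ hσt) (addIdx_subset_idx _ _)
      rcases hstep with ⟨h, _⟩ | ⟨k, _, h, _⟩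
      · exact h ▸ hu
      · exact h ▸ Finset.sdiff_subset.trans hu
    filter_upwards [Ioo_mem_nhdsGT hd] with r hr1
    exact ⟨(hr.eq_of_const_of_mem_Omega hP hΩ h0 hconst hs' r hr1.1.le hr1.2).trans hyt,
      hconst r hr1 ▸ hyt ▸ hs'⟩
  · intro t h0 _ hQ
    refine ⟨hr.eq_of_eq_left h0 h0 fun s h1 h2 => (hQ s h1 h2).1, ?_⟩
    obtain ⟨c, hc, hct, hconst⟩ := hr.exists_const_left h0 h0
    obtain ⟨r, hr1⟩ := exists_between hct
    rw [← (hconst r hr1).1]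
    exact (hQ r (hc.trans hr1.1.le) hr1.2).2

/-- A trajectory stays at an equilibrium of the subsystem of all active constraints with
nonnegative multipliers if the vector field of that subsystem is Lipschitz there. -/
theorem IsRun.rest_of_lipschitz (hr : P.IsRun P.DelayedStep y σ T) (hP : P.Admissible)
    (hz : z ∈ P.Gineq) (hgeq : P.geq z = 0) {lam : Fin m → ℝ} {N : Fin p → ℝ}
    (h : P.IsFullMultiplier (P.idx z) z lam N) (hN : ∀ i, 0 ≤ N i) {K : NNReal}
    {U : Set (Fin n → ℝ)} (hU : U ∈ 𝓝 z) (hLip : LipschitzOnWith K (P.h (P.idx z)) U)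
    (hy0 : y 0 = z) (hσ0 : σ 0 = P.idx z) : ∀ t, 0 ≤ t → y t = z ∧ σ t = P.idx z := by
  have hh : P.h (P.idx z) z = 0 := h.h_eq_zero hP hz hgeq (Finset.Subset.refl _)
  intro b hb
  refine interval_induction (Q := fun t => y t = z ∧ σ t = P.idx z) ⟨hy0, hσ0⟩ ?_ ?_ b hb le_rfl
  · rintro t h0 - ⟨hyt, hσt⟩
    obtain ⟨s', τ', hstep, d, hd, hconst⟩ := hr.exists_const_right h0
    have hs' : s' = P.idx z := by
      rw [hyt, hσt, DelayedStep, union_addIdx_of_h_eq_zero (Finset.Subset.refl _) hh] at hstep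
      rcases hstep with ⟨h', _⟩ | ⟨k, hk, _⟩
      · exact h'
      · exact absurd hk (h.not_removable hP hz hgeq (Finset.Subset.refl _) hN _ _ k)
    have hyU : ∀ᶠ r in 𝓝[>] t, y r ∈ U := (hr.tendsto_right h0).eventually (hyt ▸ hU)
    obtain ⟨d', hd', hsub⟩ := mem_nhdsGT_iff_exists_Ioo_subset.1 hyU
    have hd't : t < d' := hd'
    have hKpos : (0 : ℝ) < K + 1 := by positivity
    have hsmall : 0 < 1 / ((K : ℝ) + 1) := by positivity
    obtain ⟨e, hte, he⟩ := exists_between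
      (lt_min (lt_min hd hd't) (show t < t + 1 / ((K : ℝ) + 1) by linarith))
    have hed : e < d := he.trans_le ((min_le_left _ _).trans (min_le_left _ _))
    have hed' : e < d' := he.trans_le ((min_le_left _ _).trans (min_le_right _ _))
    have heK : e - t < 1 / ((K : ℝ) + 1) := by linarith [he.trans_le (min_le_right _ _)]
    have hKe : (K : ℝ) * (e - t) < 1 := by
      rw [lt_div_iff₀ hKpos] at heK
      nlinarith
    have hrest := eq_of_norm_le_mul_norm_sub hr.integrable hr.solution h0 hte.le K.coe_nonneg hKe
      fun r hr1 => by
        rw [hconst r ⟨hr1.1, hr1.2.trans hed⟩, hs', hyt]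
        have := hLip.norm_sub_le (hsub ⟨hr1.1, hr1.2.trans hed'⟩) (mem_of_mem_nhds hU)
        rwa [hh, sub_zero] at this
    filter_upwards [Ioo_mem_nhdsGT hte] with r hr1
    exact ⟨(hrest r ⟨hr1.1.le, hr1.2.le⟩).trans hyt,
      (hconst r ⟨hr1.1, hr1.2.trans hed⟩).trans hs'⟩
  · intro t h0 _ hQ
    refine ⟨hr.eq_of_eq_left h0 h0 fun s h1 h2 => (hQ s h1 h2).1, ?_⟩
    obtain ⟨c, hc, hct, hconst⟩ := hr.exists_const_left h0 h0
    obtain ⟨r, hr1⟩ := exists_between hct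
    rw [← (hconst r hr1).1]
    exact (hQ r (hc.trans hr1.1.le) hr1.2).2

/-! Invariant sets. -/

theorem Admissible.exists_rest_of_mem_largestInvariant (hP : P.Admissible)
    {F : Set ((ℝ → Fin n → ℝ) × (ℝ → Finset (Fin p)))} (hF : F ⊆ P.delayedFamily) {c : ℝ}
    {x : (Fin n → ℝ) × Finset (Fin p)} (hx : x ∈ P.largestInvariant F (P.Omega c)) :
    x.1 ∈ P.Omega c ∧ ∃ y ∈ F, ∀ t : ℝ, 0 ≤ t → y.1 t = x.1 := by
  obtain ⟨M, ⟨⟨_, _, hM⟩, hMΩ⟩, hxM⟩ := hx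
  obtain ⟨y, hyF, hy0, _, hyM⟩ := hM x hxM
  obtain ⟨T, hr, hσ0, _⟩ := hF hyF
  refine ⟨hMΩ x hxM, y, hyF, fun t ht => ?_⟩
  rw [hr.rest_of_mem_Omega hP hσ0 (fun t ht => hMΩ _ (hyM t ht)) t ht, hy0]

theorem Admissible.multiplier_nonneg_of_rest (hP : P.Admissible)
    {y : (ℝ → Fin n → ℝ) × (ℝ → Finset (Fin p))} (hy : y ∈ P.delayedFamily)
    (hz : z ∈ P.Gineq) (hrest : ∀ t : ℝ, 0 ≤ t → y.1 t = z) {lam : Fin m → ℝ} {N : Fin p → ℝ}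
    (hN : P.IsFullMultiplier (P.idx z) z lam N) (k : Fin p) : 0 ≤ N k := by
  obtain ⟨T, hr, _, hfreq⟩ := hy
  exact hr.multiplier_nonneg_of_rest hP hfreq hz hrest hN k

theorem Admissible.kkt_of_mem_largestInvariant (hP : P.Admissible)
    {F : Set ((ℝ → Fin n → ℝ) × (ℝ → Finset (Fin p)))} (hF : F ⊆ P.delayedFamily) {c : ℝ}
    {x : (Fin n → ℝ) × Finset (Fin p)} (hx : x ∈ P.largestInvariant F (P.Omega c)) :
    P.KKT x.1 := by
  obtain ⟨hΩ, y, hyF, hrest⟩ := hP.exists_rest_of_mem_largestInvariant hF hx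
  obtain ⟨lam, N, hN⟩ := hP.exists_multiplier_of_mem_Omega hΩ
  exact hN.kkt hΩ.2.1.1 hΩ.2.1.2 (hP.multiplier_nonneg_of_rest (hF hyF) hΩ.2.1.1 hrest hN)

theorem IsFullMultiplier.rest_mem_promptFamily {lam : Fin m → ℝ} {N : Fin p → ℝ}
    (h : P.IsFullMultiplier (P.idx z) z lam N) (hP : P.Admissible) (hz : z ∈ P.Gineq)
    (hgeq : P.geq z = 0) (hN : ∀ i, 0 ≤ N i) :
    ((fun _ => z, fun _ => P.idx z) : (ℝ → Fin n → ℝ) × (ℝ → Finset (Fin p))) ∈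
      P.promptFamily := by
  have hh : P.h (P.idx z) z = 0 := h.h_eq_zero hP hz hgeq (Finset.Subset.refl _)
  refine ⟨fun _ => 0, ⟨hz, le_rfl, fun _ _ => idx_mem_indexSets z, fun _ _ => ?_, fun _ _ => ?_,
    fun _ _ => Eventually.of_forall fun _ => ⟨rfl, rfl⟩, fun t _ => ⟨P.idx z, 0, ?_,
    Eventually.of_forall fun _ => ⟨rfl, rfl⟩⟩⟩, rfl⟩
  · exact (intervalIntegrable_const :
      IntervalIntegrable (fun _ => P.h (P.idx z) z) volume _ _)
  · simp [hh]
  · exact (h.lawStep_iff hP hz hgeq (Finset.Subset.refl _) hN _ _ _ _).2 ⟨rfl, rfl⟩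

end SwitchedProblem

end

theorem proposition6 {n m p : ℕ} (P : SwitchedProblem n m p) (hP : P.Admissible)
    (F : Set ((ℝ → Fin n → ℝ) × (ℝ → Finset (Fin p))))
    (hF₁ : P.promptFamily ⊆ F) (hF₂ : F ⊆ P.delayedFamily) :
    -- points of the largest weakly invariant set inside `Ω` satisfy the KKT conditions
    (∀ c : ℝ, ∀ x ∈ P.largestInvariant F (P.Omega c), P.KKT x.1) ∧
    -- subsystem equilibria with a negative multiplier
    (∀ A ∈ P.indexSets, ∀ z ∈ P.Gineq, P.h A z = 0 →
      ∀ (lam : Fin m → ℝ) (nu : {i // i ∈ A} → ℝ), P.IsMultiplier A z lam nu →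
      ∀ k : {i // i ∈ A}, nu k < 0 →
        -- the `k`-th constraint and `f` strictly decrease along the subsystem without `k`
        P.Jineq z k ⬝ᵥ P.h (A \ {k.1}) z < 0 ∧
        fderiv ℝ P.f z (P.h (A \ {k.1}) z) < 0 ∧
        -- the switching law removes an index with a negative multiplier, possibly `k`,
        -- as soon as the clock permits it, and then `f` strictly decreases
        (∀ t τ : ℝ, τ + P.δT < t →
          P.LawStep t z A τ (P.idx z \ {k.1}) t ∧
          ∀ s' τ', P.LawStep t z A τ s' τ' →
            (∃ j : {i // i ∈ A}, nu j < 0 ∧ s' = P.idx z \ {j.1} ∧ τ' = t) ∧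
            fderiv ℝ P.f z (P.h s' z) < 0) ∧
        -- the point is not invariant
        (∀ y ∈ F, y.1 0 = z → ∃ t : ℝ, 0 ≤ t ∧ y.1 t ≠ z) ∧
        (∀ (c : ℝ) (s : Finset (Fin p)), (z, s) ∉ P.largestInvariant F (P.Omega c))) ∧
    -- subsystem equilibria with nonnegative multipliers
    (∀ A ∈ P.indexSets, ∀ z ∈ P.Gineq, P.h A z = 0 →
      ∀ (lam : Fin m → ℝ) (nu : {i // i ∈ A} → ℝ), P.IsMultiplier A z lam nu →
      (∀ k, 0 ≤ nu k) →
        P.KKT z ∧ P.h (P.idx z) z = 0 ∧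
        -- from `A` the law passes to the set of all active constraints, and there it stays
        (∀ (t τ : ℝ) (s' : Finset (Fin p)) (τ' : ℝ),
          P.LawStep t z A τ s' τ' ↔ s' = P.idx z ∧ τ' = τ) ∧
        (∀ (t τ : ℝ) (s' : Finset (Fin p)) (τ' : ℝ),
          P.LawStep t z (P.idx z) τ s' τ' ↔ s' = P.idx z ∧ τ' = τ) ∧
        -- the point is invariant
        P.WeaklyInvariant F {(z, P.idx z)} ∧
        -- and if solutions are unique, every trajectory that starts there stays there
        ((∃ K : NNReal, ∃ U ∈ 𝓝 z, LipschitzOnWith K (P.h (P.idx z)) U) →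
          ∀ y ∈ F, y.1 0 = z → y.2 0 = P.idx z →
            ∀ t : ℝ, 0 ≤ t → y.1 t = z ∧ y.2 t = P.idx z)) := by
  refine ⟨fun c x hx => hP.kkt_of_mem_largestInvariant hF₂ hx, ?_, ?_⟩
  · intro A hA z hz h0 lam nu hmult k hk
    obtain ⟨hgeq, hAz, -⟩ := hP.equilibrium hA hz h0
    have hfull := hmult.isFullMultiplier
    have hidx := hfull.mono hAz
    set N := SwitchedProblem.extendZero A nu with hN
    have hNk : N k < 0 := by rwa [hN, SwitchedProblem.extendZero_coe]
    obtain ⟨b, hb, hJ, hf⟩ := hfull.derivatives_of_removal hP hz hgeq hAz k.2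
    have hunion := SwitchedProblem.union_addIdx_of_h_eq_zero hAz h0
    have hmove : ∀ y ∈ F, y.1 0 = z → ∃ t : ℝ, 0 ≤ t ∧ y.1 t ≠ z := by
      intro y hy _
      by_contra! hrest
      exact absurd (hP.multiplier_nonneg_of_rest (hF₂ hy) hz hrest hidx k) hNk.not_ge
    refine ⟨hJ ▸ mul_neg_of_pos_of_neg hb hNk, ?_, fun t τ ht => ⟨?_, fun s' τ' hstep => ?_⟩,
      hmove, fun c s hs => ?_⟩
    · rw [SwitchedProblem.fderiv_f, hf, neg_lt_zero]
      exact mul_pos hb (sq_pos_of_ne_zero hNk.ne)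
    · exact Or.inr ⟨k, (hfull.removable_iff hP hz hgeq hAz).2 ⟨k.2, hNk, ht⟩, by rw [hunion], rfl⟩
    · rcases hstep with ⟨hno, _⟩ | ⟨j, hj, hs', hτ'⟩
      · exact absurd ((hfull.removable_iff hP hz hgeq hAz).2 ⟨k.2, hNk, ht⟩) (hno k)
      · obtain ⟨hjA, hNj, _⟩ := (hfull.removable_iff hP hz hgeq hAz).1 hj
        rw [hunion] at hs'
        refine ⟨⟨⟨j, hjA⟩, ?_, hs', hτ'⟩, ?_⟩
        · rwa [← SwitchedProblem.extendZero_coe nu ⟨j, hjA⟩]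
        · obtain ⟨b', hb', _, hf'⟩ := hidx.derivatives_of_removal hP hz hgeq
            (Finset.Subset.refl _) (hAz hjA)
          rw [SwitchedProblem.fderiv_f, hs', hf', neg_lt_zero]
          exact mul_pos hb' (sq_pos_of_ne_zero hNj.ne)
    · obtain ⟨_, y, hyF, hrest⟩ := hP.exists_rest_of_mem_largestInvariant hF₂ hs
      obtain ⟨t, ht, hne⟩ := hmove y hyF (hrest 0 le_rfl)
      exact hne (hrest t ht)
  · intro A hA z hz h0 lam nu hmult hnu
    obtain ⟨hgeq, hAz, -⟩ := hP.equilibrium hA hz h0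
    have hfull := hmult.isFullMultiplier
    have hidx := hfull.mono hAz
    have hrefl := Finset.Subset.refl (P.idx z)
    have hN : ∀ i, 0 ≤ SwitchedProblem.extendZero A nu i := by
      intro i
      by_cases hi : i ∈ A
      · exact (SwitchedProblem.extendZero_coe nu ⟨i, hi⟩).symm ▸ hnu ⟨i, hi⟩
      · exact (SwitchedProblem.extendZero_of_notMem nu hi).ge
    refine ⟨hidx.kkt hz hgeq hN, hidx.h_eq_zero hP hz hgeq hrefl,
      hfull.lawStep_iff hP hz hgeq hAz hN, hidx.lawStep_iff hP hz hgeq hrefl hN,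
      ⟨Set.singleton_nonempty _, ?_, ?_⟩, ?_⟩
    · rintro x rfl
      exact SwitchedProblem.idx_mem_indexSets z
    · rintro x rfl
      exact ⟨_, hF₁ (hidx.rest_mem_promptFamily hP hz hgeq hN), rfl, rfl, fun _ _ => rfl⟩
    · rintro ⟨K, U, hU, hLip⟩ y hy hy0 hσ0
      obtain ⟨T, hr, -, -⟩ := hF₂ hy
      exact hr.rest_of_lipschitz hP hz hgeq hidx hN hU hLip hy0 hσ0
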